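/- For $\kappa,\mu\in\mathbb C$ with $\Re(\tfrac12+\mu-\kappa)>0$ and $y>0$ let $$W_{\kappa,\mu}(y)=\frac{e^{-y/2}y^{\mu+1/2}}{\Gamma(\frac12+\mu-\kappa)}\int_0^\infty e^{-yx}x^{\mu-\kappa-1/2}(1+x)^{\mu+\kappa-1/2}\,dx$$ be the Whittaker function. Let $p\in\{1,-1\}$. (a) Let $s_0\in\mathbb C$ be fixed with $0<\Re s_0<1$. For $t\in\mathbb R$ put $s=\tfrac12+it$, $w=1-s$ and $$G(t)=\frac{1}{\Gamma(w+p/4)}\int_0^\infty W_{0,s_0-1/2}(y)\,W_{p/4,w-1/2}(y)\,y^{s-1}\,\frac{dy}{y}.$$ The integral converges absolutely for every $t\in\mathbb R$, and $G(t)=O((1+|t|)^{-1/2})$ as $|t|\to\infty$, with an implied constant that may depend on $s_0$ and $p$. The bound is sharp: there is a constant $c=c(s_0,p)>0$ with $$\lim_{|t|\to\infty}\frac{|G(t)|}{(1+|t|)^{-1/2}}=c.$$ (b) For $u,t\in\mathbb R$ the integral below converges absolutely, and $$\frac{1}{|\Gamma(\frac12+\frac p4+it)|^2}\int_0^\infty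 y^{-1/2+iu}\,\bigl|W_{p/4,it}(y)\bigr|^2\,\frac{dy}{y}=O((1+|t|)^{-1/2})\qquad\text{as }|t|\to\infty,$$ uniformly in $u$: there are constants $C,T$, depending at most on $p$, such that for all $u,t\in\mathbb R$ with $|t|\ge T$ the absolute value of the left-hand side is at most $C(1+|t|)^{-1/2}$. -/

import Mathlib

open Filter MeasureTheory Set Topology Asymptotics

noncomputable section

/-- The Whittaker function `W_{κ,μ}(y)` for `y > 0`, i.e. the solution of
`W'' + (-1/4 + κ/y + (1/4 - μ²)/y²) W = 0` with `W(y) ~ y^κ e^{-y/2}` as `y → ∞`,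
given by its standard integral representation
`W_{κ,μ}(y) = e^{-y/2} y^{μ+1/2} / Γ(1/2+μ-κ) * ∫_0^∞ e^{-yx} x^{μ-κ-1/2} (1+x)^{μ+κ-1/2} dx`,
which converges, and is the usual definition, in the range `Re(1/2 + μ - κ) > 0`. The function is
only used in that range: `κ = 0`, `μ = s₀ - 1/2` with `0 < Re s₀`, and `κ = ±1/4`, `Re μ = 0`. -/
def whittakerW (κ μ : ℂ) (y : ℝ) : ℂ :=
  Complex.exp (-(y : ℂ) / 2) * (y : ℂ) ^ (μ + 1 / 2) / Complex.Gamma (1 / 2 + μ - κ) *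
    ∫ x in Ioi (0 : ℝ), Complex.exp (-((y : ℂ) * (x : ℂ))) * (x : ℂ) ^ (μ - κ - 1 / 2) *
      (1 + (x : ℂ)) ^ (μ + κ - 1 / 2)

/-- The integrand `W_{0,s₀-1/2}(y) W_{p/4,w-1/2}(y) y^{s-1} / y`. -/
def whittakerProductIntegrand (p : ℤ) (s₀ s w : ℂ) (y : ℝ) : ℂ :=
  whittakerW 0 (s₀ - 1 / 2) y * whittakerW ((p : ℂ) / 4) (w - 1 / 2) y * (y : ℂ) ^ (s - 1) / (y : ℂ)

/-- `(1/Γ(w + p/4)) ∫_0^∞ W_{0,s₀-1/2}(y) W_{p/4,w-1/2}(y) y^{s-1} dy/y`. -/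
def normalizedProductMellin (p : ℤ) (s₀ s w : ℂ) : ℂ :=
  1 / Complex.Gamma (w + (p : ℂ) / 4) *
    ∫ y in Ioi (0 : ℝ), whittakerProductIntegrand p s₀ s w y

/-- The integrand `y^{-1/2+iu} |W_{p/4,it}(y)|² / y`. -/
def whittakerSquareIntegrand (p : ℤ) (u t : ℝ) (y : ℝ) : ℂ :=
  (y : ℂ) ^ (-(1 / 2 : ℂ) + Complex.I * u) *
    ((‖whittakerW ((p : ℂ) / 4) (Complex.I * t) y‖ ^ 2 : ℝ) : ℂ) / (y : ℂ)

/-- `(1/|Γ(1/2 + p/4 + it)|²) ∫_0^∞ y^{-1/2+iu} |W_{p/4,it}(y)|² dy/y`. -/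
def normalizedSquareMellin (p : ℤ) (u t : ℝ) : ℂ :=
  1 / ((‖Complex.Gamma (1 / 2 + (p : ℂ) / 4 + Complex.I * t)‖ ^ 2 : ℝ) : ℂ) *
    ∫ y in Ioi (0 : ℝ), whittakerSquareIntegrand p u t y

end

/-! Both integrals become explicit hypergeometric series. Up to Gamma factors, a product of two
Whittaker functions times the given power of `y` is `y^(c-1) e^(-y)` times two Laplace transforms of
kernels `v^(a-1) (1+v)^(d-1)`. In (a) the relation `s + w = 1` leaves `c = s₀`; in (b) `c = 1/2 +
iu`. Integrating over `y` first gives `Γ(c) (1+v+x)^(-c)`. Writing `1+v+x = (1+v)(1+x)(1-z)` with `z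
= v/(1+v) · x/(1+x)` and expanding `(1-z)^(-c)` separates the variables, so that each term is a
product of two Beta integrals (`hasSum_integral_eulerLaplace_mul`).

For (a), with `r_n = (s₀)_n/n!`, the first Beta factor is again proportional to `r_n`. The series is
therefore `∑ r_n² B(a+n, b+1)`, where `a = w - p/4` and `b = s₀ - 2w`. Since `r_n²` has size
`n^(2σ-2)`, `σ = Re s₀`, it need not be summable, and termwise limits are not immediately allowed.
As `B(a+n, b+1) = B(a+n, b) - B(a+n+1, b)`, summation by parts replaces `r_n²` by its differences,
of size `n^(2σ-3)` (`hasSum_risingSqDiff_of_hasSum`). Now `B(a+n, b) = B(a, b) (a)_n/(a+b)_n`. On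
the critical line `a` and `a+b` have imaginary parts near `-t` and `t`, so the quotient tends to
`(-1)^n` and is `O((n+1)^(1-σ))` uniformly in large `|t|`. Dominated convergence gives the limit `∑
(-1)^n (r_n² - r_{n-1}²)` with `r_{-1} = 0`, a nonzero Gamma quotient by
`tsum_alternating_risingSqDiff`. The remaining Gamma prefactor has size exactly `|t|^(-1/2)`, by
duplication and the asymptotics of `Γ(s+α)/Γ(s)`. This gives the limit, and hence the upper bound.

For (b), taking absolute values reduces to `u = 0`, where the series has nonnegative terms. Its
`n`-th term is at most a constant times `|Γ(1/2-2it)|² / (√(n+1) (n+1+|t|))`. The sum over `n` gives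
`|t|^(-1/2)`, and duplication bounds the Gamma factor by the normalization. -/

/-! ### Binomial series coefficients and their growth. -/

/-- The coefficient `(c)_n / n!` of the binomial series of `(1 - z) ^ (-c)`. -/
noncomputable def risingCoeff (c : ℂ) (n : ℕ) : ℂ := ∏ k ∈ Finset.range n, (c + k) / (k + 1)

lemma risingCoeff_zero (c : ℂ) : risingCoeff c 0 = 1 := by simp [risingCoeff]

lemma risingCoeff_succ (c : ℂ) (n : ℕ) :
    risingCoeff c (n + 1) = risingCoeff c n * ((c + n) / (n + 1)) := by
  rw [risingCoeff, Finset.prod_range_succ, risingCoeff]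

lemma Gamma_add_nat_eq {c : ℂ} (hc : ∀ m : ℕ, c ≠ -m) (n : ℕ) :
    Complex.Gamma (c + n) = Complex.Gamma c * ∏ k ∈ Finset.range n, (c + k) := by
  induction n with
  | zero => simp
  | succ n ih =>
    have h : c + n ≠ 0 := fun h => hc n (eq_neg_of_add_eq_zero_left h)
    rw [Finset.prod_range_succ, ← mul_assoc, ← ih, Nat.cast_succ, ← add_assoc,
      Complex.Gamma_add_one _ h, mul_comm]

lemma risingCoeff_eq_prod_div (c : ℂ) (n : ℕ) :
    risingCoeff c n = (∏ k ∈ Finset.range n, (c + k)) / (n.factorial : ℂ) := by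
  rw [risingCoeff, Finset.prod_div_distrib, ← Finset.prod_range_add_one_eq_factorial]
  push_cast
  rfl

lemma ne_neg_nat_of_re_pos {c : ℂ} (hc : 0 < c.re) (m : ℕ) : c ≠ -m := by
  rintro rfl
  simp only [Complex.neg_re, Complex.natCast_re] at hc
  have : (0 : ℝ) ≤ m := m.cast_nonneg
  linarith

lemma ne_neg_nat_of_im_ne_zero {c : ℂ} (hc : c.im ≠ 0) (m : ℕ) : c ≠ -m := by
  rintro rfl
  simp at hc

lemma Gamma_add_nat_eq_risingCoeff {c : ℂ} (hc : ∀ m : ℕ, c ≠ -m) (n : ℕ) :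
    Complex.Gamma (c + n) = Complex.Gamma c * risingCoeff c n * (n.factorial : ℂ) := by
  have : (n.factorial : ℂ) ≠ 0 := by exact_mod_cast n.factorial_ne_zero
  rw [Gamma_add_nat_eq hc, risingCoeff_eq_prod_div]
  field_simp

lemma risingCoeff_eq_choose (c : ℂ) (n : ℕ) : risingCoeff c n = Ring.choose (c + n - 1) n := by
  have h := Ring.factorial_nsmul_multichoose_eq_ascPochhammer c n
  have hf : (n.factorial : ℂ) ≠ 0 := by exact_mod_cast n.factorial_ne_zero
  have e : Ring.choose (c + n - 1) n = Ring.multichoose c n := by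
    rw [Ring.choose]; congr 1; ring
  rw [e, risingCoeff_eq_prod_div, div_eq_iff hf, mul_comm, ← nsmul_eq_mul, h,
    Polynomial.ascPochhammer_smeval_eq_eval]
  clear h e hf
  induction n with
  | zero => simp
  | succ n ih => rw [Finset.prod_range_succ, ih, ascPochhammer_succ_eval]

lemma hasSum_risingCoeff (c : ℂ) {z : ℂ} (hz : ‖z‖ < 1) :
    HasSum (fun n => risingCoeff c n * z ^ n) ((1 - z) ^ (-c)) := by
  have h := (Complex.one_div_one_sub_cpow_hasFPowerSeriesOnBall_zero c).hasSum (y := z)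
    (by
      rw [Metric.mem_eball, edist_zero_right, ← ofReal_norm]
      exact ENNReal.ofReal_lt_one.mpr hz)
  simp only [FormalMultilinearSeries.ofScalars_apply_eq, zero_add] at h
  rw [Complex.cpow_neg, ← one_div]
  simpa only [risingCoeff_eq_choose, smul_eq_mul] using h

lemma norm_risingCoeff_ofReal {σ : ℝ} (hσ : 0 < σ) (n : ℕ) :
    ((‖risingCoeff (σ : ℂ) n‖ : ℝ) : ℂ) = risingCoeff σ n := by
  have : risingCoeff (σ : ℂ) n = ((∏ k ∈ Finset.range n, (σ + k) / (k + 1) : ℝ) : ℂ) := by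
    simp [risingCoeff]
  rw [this, Complex.norm_real, Real.norm_of_nonneg]
  exact Finset.prod_nonneg fun k _ => by positivity

lemma hasSum_norm_risingCoeff {σ : ℝ} (hσ : 0 < σ) {z : ℝ} (h0 : 0 ≤ z) (h1 : z < 1) :
    HasSum (fun n => ‖risingCoeff (σ : ℂ) n‖ * z ^ n) ((1 - z) ^ (-σ)) := by
  rw [← Complex.hasSum_ofReal]
  have := hasSum_risingCoeff (σ : ℂ) (z := z) (by rwa [Complex.norm_real, Real.norm_of_nonneg h0])
  convert this using 1
  · ext n
    rw [Complex.ofReal_mul, norm_risingCoeff_ofReal hσ, Complex.ofReal_pow]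
  · rw [Complex.ofReal_cpow (by linarith)]; push_cast; rfl

/-- This is the reciprocal of Euler's limit formula for the Gamma function. -/
lemma tendsto_risingCoeff (c : ℂ) (hc : ∀ m : ℕ, c ≠ -m) :
    Tendsto (fun n : ℕ => risingCoeff c (n + 1) * (n + 1) / (n : ℂ) ^ c) atTop
      (𝓝 (Complex.Gamma c)⁻¹) := by
  have h := (Complex.GammaSeq_tendsto_Gamma c).inv₀ (Complex.Gamma_ne_zero hc)
  refine h.congr fun n => ?_
  have hf : (n.factorial : ℂ) ≠ 0 := by exact_mod_cast n.factorial_ne_zero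
  have hn : (n : ℂ) + 1 ≠ 0 := by exact_mod_cast n.succ_ne_zero
  rw [Complex.GammaSeq, risingCoeff_eq_prod_div, Nat.factorial_succ]
  push_cast
  rw [inv_div]
  field_simp

lemma exists_norm_risingCoeff_le {c : ℂ} (hc : 0 < c.re) :
    ∃ K : ℝ, 0 < K ∧ ∀ n : ℕ, ‖risingCoeff c n‖ ≤ K * ((n : ℝ) + 1) ^ (c.re - 1) := by
  obtain ⟨K, hK⟩ := (tendsto_risingCoeff c (ne_neg_nat_of_re_pos hc)).norm.bddAbove_range
  have hK0 : 0 ≤ K := (norm_nonneg _).trans (hK ⟨0, rfl⟩)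
  have h2 : (0 : ℝ) < 2 ^ (c.re - 1) := by positivity
  refine ⟨2 * K + 1 + ‖risingCoeff c 1‖ / 2 ^ (c.re - 1), by positivity, fun n => ?_⟩
  have hq : 0 ≤ ‖risingCoeff c 1‖ / 2 ^ (c.re - 1) := by positivity
  -- The bounded sequence at index `n` controls coefficient `n + 1`, and at index `0` its
  -- denominator `0 ^ c` vanishes. So coefficients `0` and `1` need their own share of the constant.
  rcases n with _ | _ | m
  · simp only [risingCoeff_zero, norm_one, Nat.cast_zero, zero_add, Real.one_rpow, mul_one]
    linarith
  · have e : ((0 + 1 : ℕ) : ℝ) + 1 = 2 := by norm_num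
    rw [e, add_mul, div_mul_cancel₀ _ h2.ne', zero_add]
    have : 0 ≤ (2 * K + 1) * 2 ^ (c.re - 1) := by positivity
    linarith
  · have h := hK ⟨m + 1, rfl⟩
    have hm : (0 : ℝ) < (m + 1 : ℕ) := by positivity
    have hp : 0 < ((m + 1 : ℕ) : ℝ) ^ c.re := by positivity
    have e1 : ‖((m + 1 : ℕ) : ℂ) ^ c‖ = ((m + 1 : ℕ) : ℝ) ^ c.re :=
      Complex.norm_natCast_cpow_of_pos (by positivity) c
    have e2 : ‖((m + 1 : ℕ) : ℂ) + 1‖ = ((m + 1 : ℕ) : ℝ) + 1 := by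
      exact_mod_cast Complex.norm_natCast (m + 1 + 1)
    dsimp only at h
    rw [norm_div, norm_mul, e1, e2, div_le_iff₀ hp] at h
    push_cast at h hp hm ⊢
    set x : ℝ := (m : ℝ) + 1 with hx
    have hx1 : 1 ≤ x := by simp [hx]
    have e0 : x + 1 + 1 = x + 2 := by ring
    have hle : x ^ c.re ≤ (x + 2) ^ c.re :=
      Real.rpow_le_rpow hm.le (by linarith) hc.le
    have e3 : (x + 2) ^ c.re = (x + 2) ^ (c.re - 1) * (x + 2) := by
      rw [Real.rpow_sub_one (by positivity)]; field_simp
    have hpp : 0 < (x + 2) ^ (c.re - 1) := by positivity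
    have h4 : ‖risingCoeff c (m + 1 + 1)‖ ≤ 2 * K * (x + 2) ^ (c.re - 1) := by
      have h5 : K * x ^ c.re ≤ K * ((x + 2) ^ (c.re - 1) * (2 * (x + 1))) := by
        refine mul_le_mul_of_nonneg_left (hle.trans ?_) hK0
        rw [e3]
        exact mul_le_mul_of_nonneg_left (by linarith) hpp.le
      have : ‖risingCoeff c (m + 1 + 1)‖ * (x + 1) ≤ 2 * K * (x + 2) ^ (c.re - 1) * (x + 1) := by
        linarith
      exact le_of_mul_le_mul_right this (by positivity)
    rw [e0]
    exact h4.trans (mul_le_mul_of_nonneg_right (by linarith) hpp.le)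

/-- Both coefficient sequences grow like constants times `n^(Re c - 1)`. Comparing with the real
parameter, rather than with a power, gives a majorant whose generating series is known exactly:
`(1-z)^(-Re c)`. -/
lemma exists_norm_risingCoeff_le_re {c : ℂ} (hc : 0 < c.re) :
    ∃ K : ℝ, 0 < K ∧ ∀ n : ℕ, ‖risingCoeff c n‖ ≤ K * ‖risingCoeff (c.re : ℂ) n‖ := by
  have hc' : 0 < (c.re : ℂ).re := by simpa using hc
  have h := ((tendsto_risingCoeff c (ne_neg_nat_of_re_pos hc)).div
    (tendsto_risingCoeff (c.re : ℂ) (ne_neg_nat_of_re_pos hc'))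
    (inv_ne_zero (Complex.Gamma_ne_zero_of_re_pos hc'))).norm
  obtain ⟨K, hK⟩ := h.bddAbove_range
  have hK0 : 0 ≤ K := (norm_nonneg _).trans (hK ⟨0, rfl⟩)
  have hpos : ∀ n, 0 < ‖risingCoeff (c.re : ℂ) n‖ := fun n => by
    rw [norm_pos_iff, risingCoeff, Finset.prod_ne_zero_iff]
    intro k _
    refine div_ne_zero (fun h => ne_neg_nat_of_re_pos hc' k (eq_neg_of_add_eq_zero_left h)) ?_
    exact_mod_cast k.succ_ne_zero
  refine ⟨K + 1 + ‖risingCoeff c 1‖ / ‖risingCoeff (c.re : ℂ) 1‖, by positivity, fun n => ?_⟩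
  have hq : 0 ≤ ‖risingCoeff c 1‖ / ‖risingCoeff (c.re : ℂ) 1‖ := by positivity
  rcases n with _ | _ | m
  · simp only [risingCoeff_zero, norm_one, mul_one]
    linarith
  · rw [zero_add, add_mul, div_mul_cancel₀ _ (hpos 1).ne']
    have : 0 ≤ (K + 1) * ‖risingCoeff (c.re : ℂ) 1‖ := by positivity
    linarith
  · have h := hK ⟨m + 1, rfl⟩
    have hm : (0 : ℝ) < (m + 1 : ℕ) := by positivity
    have hp : 0 < ((m + 1 : ℕ) : ℝ) ^ c.re := by positivity
    have e1 : ∀ w : ℂ, ‖((m + 1 : ℕ) : ℂ) ^ w‖ = ((m + 1 : ℕ) : ℝ) ^ w.re :=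
      Complex.norm_natCast_cpow_of_pos (by positivity)
    have e2 : 0 < ‖((m + 1 : ℕ) : ℂ) + 1‖ := by
      rw [norm_pos_iff]; exact_mod_cast (m + 1).succ_ne_zero
    simp only [Pi.div_apply, norm_div, norm_mul, e1, Complex.ofReal_re] at h
    rw [div_div_div_cancel_right₀ hp.ne', mul_div_mul_right _ _ e2.ne',
      div_le_iff₀ (hpos _)] at h
    refine h.trans ?_
    gcongr
    linarith

/-! ### Uniform asymptotics of Gamma quotients. -/

/-- The quotient `Γ(s + α) / (Γ(s) s ^ α)`. -/
noncomputable def gammaRatio (α s : ℂ) : ℂ :=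
  Complex.Gamma (s + α) / Complex.Gamma s * Complex.exp (-α * Complex.log s)

/-- Far to the right the ratio is a quotient of two Euler sequences `Complex.GammaSeq`, normalized
by their limits, times `(1 + (s+1)/n)^(-α)`. -/
lemma tendsto_gammaRatio_add_nat (α : ℂ) {s : ℂ} (hs : s.im ≠ 0) (hsα : (s + α).im ≠ 0) :
    Tendsto (fun n : ℕ => gammaRatio α (s + (n + 1 : ℕ))) atTop (𝓝 1) := by
  have hG := Complex.Gamma_ne_zero (ne_neg_nat_of_im_ne_zero hs)
  have hGα := Complex.Gamma_ne_zero (ne_neg_nat_of_im_ne_zero hsα)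
  have h1 : Tendsto (fun n : ℕ => Complex.Gamma (s + α) / Complex.Gamma s *
      (Complex.GammaSeq s n / Complex.GammaSeq (s + α) n)) atTop (𝓝 1) := by
    have := ((Complex.GammaSeq_tendsto_Gamma s).div (Complex.GammaSeq_tendsto_Gamma (s + α))
      hGα).const_mul (Complex.Gamma (s + α) / Complex.Gamma s)
    rwa [div_mul_div_cancel₀ hG, div_self hGα] at this
  have h2 : Tendsto (fun n : ℕ => Complex.exp (-α * Complex.log (1 + (s + 1) / n))) atTop
      (𝓝 1) := by
    have h3 : Tendsto (fun n : ℕ => 1 + (s + 1) / (n : ℂ)) atTop (𝓝 (1 + 0)) :=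
      tendsto_const_nhds.add (tendsto_const_div_atTop_nhds_zero_nat _)
    rw [add_zero] at h3
    have h4 := ((h3.clog (by simp)).const_mul (-α)).cexp
    simpa using h4
  have h5 := h1.mul h2
  rw [mul_one] at h5
  refine h5.congr' ?_
  filter_upwards [eventually_gt_atTop 0] with n hn
  have hn0 : (n : ℂ) ≠ 0 := by exact_mod_cast hn.ne'
  have hp : ∀ {z : ℂ}, z.im ≠ 0 → ∏ k ∈ Finset.range (n + 1), (z + k) ≠ 0 := fun hz => by
    rw [Finset.prod_ne_zero_iff]
    exact fun k _ h => ne_neg_nat_of_im_ne_zero hz k (eq_neg_of_add_eq_zero_left h)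
  have hf : (n.factorial : ℂ) ≠ 0 := by exact_mod_cast n.factorial_ne_zero
  have hz : s + ((n + 1 : ℕ) : ℂ) = ((n : ℝ) : ℂ) * (1 + (s + 1) / n) := by
    push_cast
    field_simp
    ring
  have hne : 1 + (s + 1) / n ≠ 0 := by
    intro h
    have : s + ((n + 1 : ℕ) : ℂ) = 0 := by rw [hz, h, mul_zero]
    exact ne_neg_nat_of_im_ne_zero hs _ (eq_neg_of_add_eq_zero_left this)
  rw [gammaRatio, add_right_comm, Gamma_add_nat_eq (ne_neg_nat_of_im_ne_zero hs),
    Gamma_add_nat_eq (ne_neg_nat_of_im_ne_zero hsα), hz,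
    Complex.log_ofReal_mul (by exact_mod_cast hn) hne, Complex.GammaSeq, Complex.GammaSeq,
    Complex.cpow_add _ _ hn0, mul_add, Complex.exp_add, Complex.cpow_def_of_ne_zero hn0 α,
    ← Complex.ofReal_natCast, ← Complex.ofReal_log n.cast_nonneg]
  have e : Complex.exp (-α * (Real.log n : ℂ)) = (Complex.exp ((Real.log n : ℂ) * α))⁻¹ := by
    rw [← Complex.exp_neg]; ring_nf
  have hp1 := hp hs
  have hp2 := hp hsα
  have hexp := Complex.exp_ne_zero ((Real.log n : ℂ) * α)
  have hpow : ((n : ℝ) : ℂ) ^ s ≠ 0 := by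
    rw [Complex.ofReal_natCast]; exact (Complex.cpow_ne_zero_iff_of_exponent_ne_zero (by rintro rfl; simp at hs)).mpr hn0
  rw [e]
  field_simp

/-- The imaginary parts of `s` and `1 + 1/s` have opposite signs, so their arguments add without
leaving the principal branch. -/
lemma log_add_one_eq {s : ℂ} (hs : s.im ≠ 0) :
    Complex.log (s + 1) = Complex.log s + Complex.log (1 + 1 / s) := by
  have hs0 : s ≠ 0 := by rintro rfl; simp at hs
  have h1 : s + 1 ≠ 0 := by
    intro h
    have := congrArg Complex.im h
    simp at this
    exact hs this
  have e : s + 1 = s * (1 + 1 / s) := by field_simp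
  have h2 : 1 + 1 / s ≠ 0 := by
    intro h
    rw [h, mul_zero] at e
    exact h1 e
  have him : (1 + 1 / s).im = -s.im / Complex.normSq s := by
    simp [Complex.inv_im]
  have hN : 0 < Complex.normSq s := Complex.normSq_pos.mpr hs0
  rw [e, Complex.log_mul hs0 h2]
  have a1 := Complex.neg_pi_lt_arg s
  have a2 := Complex.arg_le_pi s
  have a3 := Complex.neg_pi_lt_arg (1 + 1 / s)
  have a4 := Complex.arg_le_pi (1 + 1 / s)
  rcases lt_or_gt_of_ne hs with h | h
  · have b1 : s.arg < 0 := Complex.arg_neg_iff.mpr h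
    have b2 : 0 ≤ (1 + 1 / s).arg := Complex.arg_nonneg_iff.mpr (by
      rw [him]; exact div_nonneg (by linarith) hN.le)
    constructor <;> linarith
  · have b1 : 0 ≤ s.arg := Complex.arg_nonneg_iff.mpr h.le
    have b2 : (1 + 1 / s).arg < 0 := Complex.arg_neg_iff.mpr (by
      rw [him]; exact div_neg_of_neg_of_pos (by linarith) hN)
    constructor <;> linarith

lemma gammaRatio_add_one (α : ℂ) {s : ℂ} (hs : s.im ≠ 0) (hsα : (s + α).im ≠ 0) :
    gammaRatio α (s + 1) = gammaRatio α s *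
      Complex.exp (Complex.log (1 + α / s) - α * Complex.log (1 + 1 / s)) := by
  have hs0 : s ≠ 0 := by rintro rfl; simp at hs
  have hsα0 : s + α ≠ 0 := by intro h; simp [h] at hsα
  have h1 : 1 + α / s ≠ 0 := by
    intro h
    apply hsα0
    field_simp at h
    simpa using h
  have hG := Complex.Gamma_ne_zero (ne_neg_nat_of_im_ne_zero hs)
  rw [gammaRatio, gammaRatio, add_right_comm, Complex.Gamma_add_one _ hs0,
    Complex.Gamma_add_one _ hsα0, log_add_one_eq hs, Complex.exp_sub, Complex.exp_log h1, mul_add,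
    Complex.exp_add, neg_mul, neg_mul, Complex.exp_neg (α * Complex.log (1 + 1 / s))]
  field_simp

/-- The first-order terms `α/s` cancel. The resulting quadratic decay makes the corrections summable
along `s, s+1, s+2, …`. -/
lemma norm_log_sub_mul_log_le (α : ℂ) {s : ℂ} (hs : 2 * (1 + ‖α‖) ≤ ‖s‖) :
    ‖Complex.log (1 + α / s) - α * Complex.log (1 + 1 / s)‖ ≤ (‖α‖ ^ 2 + ‖α‖) / ‖s‖ ^ 2 := by
  have hα := norm_nonneg α
  have hs0 : 0 < ‖s‖ := by linarith
  have key : ∀ w : ℂ, ‖w‖ ≤ 1 + ‖α‖ →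
      ‖Complex.log (1 + w / s) - w / s‖ ≤ ‖w‖ ^ 2 / ‖s‖ ^ 2 := by
    intro w hw
    have h1 : ‖w / s‖ ≤ 1 / 2 := by
      rw [norm_div, div_le_div_iff₀ hs0 two_pos]; linarith
    have h2 := Complex.norm_log_one_add_sub_self_le (z := w / s) (by linarith)
    refine h2.trans ?_
    have h3 : (1 - ‖w / s‖)⁻¹ ≤ 2 := by
      rw [inv_le_comm₀ (by linarith) two_pos]; linarith
    rw [← div_pow, ← norm_div]
    have := mul_le_mul_of_nonneg_left h3 (sq_nonneg ‖w / s‖)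
    linarith
  have k1 := key α (by linarith)
  have k2 := key 1 (by simp)
  have e : Complex.log (1 + α / s) - α * Complex.log (1 + 1 / s) =
      (Complex.log (1 + α / s) - α / s) - α * (Complex.log (1 + 1 / s) - 1 / s) := by ring
  rw [e, add_div]
  refine (norm_sub_le _ _).trans (add_le_add k1 ?_)
  rw [norm_mul, ← mul_one_div ‖α‖]
  gcongr
  simpa using k2

lemma sum_inv_norm_sq_le {s : ℂ} (hs : 0 ≤ s.re) (hs' : 1 < |s.im|) (n : ℕ) :
    ∑ k ∈ Finset.range n, 1 / ‖s + k‖ ^ 2 ≤ 2 / (|s.im| - 1) := by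
  -- The bound is strengthened to a telescoping one so that induction closes.
  have h : ∀ n : ℕ, ∑ k ∈ Finset.range n, 1 / ‖s + k‖ ^ 2 ≤
      2 / (|s.im| - 1) - 2 / (|s.im| - 1 + n) := by
    intro n
    induction n with
    | zero => simp
    | succ n ih =>
      rw [Finset.sum_range_succ]
      have hn : (0 : ℝ) ≤ n := n.cast_nonneg
      have h1 : ‖s + n‖ ^ 2 = (s.re + n) ^ 2 + |s.im| ^ 2 := by
        rw [Complex.sq_norm, Complex.normSq_apply, sq_abs]; simp; ring
      set T := |s.im| - 1 with hT
      have hT0 : 0 < T := by linarith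
      have h2 : |s.im| = T + 1 := by ring
      have h3 : (T + n) * (T + (n + 1)) / 2 ≤ ‖s + n‖ ^ 2 := by
        rw [h1, h2]
        nlinarith [sq_nonneg (T + 1 - n), mul_nonneg hs hn, sq_nonneg s.re]
      have h4 : 1 / ‖s + n‖ ^ 2 ≤ 2 / (T + n) - 2 / (T + (n + 1)) := by
        have : 2 / (T + n) - 2 / (T + (n + 1)) = 1 / ((T + n) * (T + (n + 1)) / 2) := by
          field_simp; ring
        rw [this]
        exact one_div_le_one_div_of_le (by positivity) h3
      push_cast
      linarith
  refine (h n).trans ?_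
  have : 0 ≤ 2 / (|s.im| - 1 + n) := by
    have hn : (0 : ℝ) ≤ n := n.cast_nonneg
    apply div_nonneg two_pos.le; linarith
  linarith

lemma gammaRatio_add_nat (α : ℂ) {s : ℂ} (hs : s.im ≠ 0) (hsα : (s + α).im ≠ 0) (n : ℕ) :
    gammaRatio α (s + n) = gammaRatio α s * Complex.exp (∑ k ∈ Finset.range n,
      (Complex.log (1 + α / (s + k)) - α * Complex.log (1 + 1 / (s + k)))) := by
  induction n with
  | zero => simp
  | succ n ih =>
    rw [Nat.cast_succ, ← add_assoc, gammaRatio_add_one α (by simpa using hs)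
      (by simpa using hsα), ih, Finset.sum_range_succ, Complex.exp_add, mul_assoc]

/-- `Γ(s + α) / Γ(s) ~ s ^ α` for `|Im s| → ∞`, uniformly in the half plane `Re s ≥ 0`. -/
lemma gammaRatio_sub_one_le (α : ℂ) {ε : ℝ} (hε : 0 < ε) :
    ∃ T : ℝ, 1 ≤ T ∧ ∀ s : ℂ, 0 ≤ s.re → T ≤ |s.im| → ‖gammaRatio α s - 1‖ ≤ ε := by
  obtain ⟨δ, hδ, hexp⟩ : ∃ δ > 0, ∀ z : ℂ, ‖z‖ ≤ δ → ‖Complex.exp (-z) - 1‖ ≤ ε := by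
    have h : Tendsto (fun z : ℂ => Complex.exp (-z)) (𝓝 0) (𝓝 1) := by
      have : Continuous fun z : ℂ => Complex.exp (-z) := by fun_prop
      simpa using this.tendsto 0
    obtain ⟨δ, hδ, h⟩ := Metric.tendsto_nhds_nhds.mp h ε hε
    refine ⟨δ / 2, by positivity, fun z hz => ?_⟩
    have := h (x := z) (by rw [dist_zero_right]; linarith)
    rw [dist_eq_norm] at this
    exact this.le
  set A := ‖α‖ ^ 2 + ‖α‖ with hA
  have hα := norm_nonneg α
  have hA0 : 0 ≤ A := by positivity
  -- The first summand makes the logarithm estimate valid at every `s + k`; the second makes the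
  -- accumulated correction at most `δ`.
  refine ⟨2 * (1 + ‖α‖) + 2 * A / δ, ?_, fun s hs hT => ?_⟩
  · have : 0 ≤ 2 * A / δ := by positivity
    linarith
  have hq : 0 ≤ 2 * A / δ := by positivity
  have him : s.im ≠ 0 := by
    intro h
    rw [h, abs_zero] at hT
    linarith
  have himα : (s + α).im ≠ 0 := by
    intro h
    have h1 : s.im = -α.im := by
      rw [Complex.add_im] at h; linarith
    have h2 := Complex.abs_im_le_norm α
    rw [h1, abs_neg] at hT
    linarith
  set D : ℕ → ℂ := fun n => ∑ k ∈ Finset.range n,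
      (Complex.log (1 + α / (s + k)) - α * Complex.log (1 + 1 / (s + k))) with hD
  have hDn : ∀ n, ‖D n‖ ≤ δ := by
    intro n
    have h1 : ‖D n‖ ≤ ∑ k ∈ Finset.range n, A * (1 / ‖s + k‖ ^ 2) := by
      refine norm_sum_le_of_le _ fun k _ => ?_
      rw [mul_one_div]
      refine norm_log_sub_mul_log_le α ?_
      refine le_trans ?_ (Complex.abs_im_le_norm _)
      simp only [Complex.add_im, Complex.natCast_im, add_zero]
      linarith
    rw [← Finset.mul_sum] at h1
    refine h1.trans ((mul_le_mul_of_nonneg_left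
      (sum_inv_norm_sq_le hs (by linarith) n) hA0).trans ?_)
    have h2 : 0 < |s.im| - 1 := by linarith
    rw [← mul_div_assoc, div_le_iff₀ h2]
    have h3 : 2 * A / δ ≤ |s.im| - 1 := by linarith
    rw [div_le_iff₀ hδ] at h3
    linarith
  have hlim := tendsto_gammaRatio_add_nat α him himα
  -- The value at `s` is recovered from the values at `s + n + 1`, which tend to `1`; the correction
  -- factor between them is within `ε` of `1`, uniformly in `n`.
  have h2 : ∀ n, ‖gammaRatio α s - gammaRatio α (s + (n + 1 : ℕ))‖ ≤
      ‖gammaRatio α (s + (n + 1 : ℕ))‖ * ε := by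
    intro n
    have h3 := gammaRatio_add_nat α him himα (n + 1)
    have h4 : gammaRatio α s - gammaRatio α (s + (n + 1 : ℕ)) =
        gammaRatio α (s + (n + 1 : ℕ)) * (Complex.exp (-D (n + 1)) - 1) := by
      rw [h3, Complex.exp_neg]
      have := Complex.exp_ne_zero (D (n + 1))
      simp only [hD] at this ⊢
      field_simp
    rw [h4, norm_mul]
    gcongr
    exact hexp _ (hDn _)
  have h5 := le_of_tendsto_of_tendsto' (hlim.const_sub _).norm (hlim.norm.mul_const ε) h2
  simpa using h5

lemma tendsto_gammaRatio (α : ℂ) :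
    Tendsto (fun t : ℝ => gammaRatio α (Complex.I * t)) (comap (fun t : ℝ => |t|) atTop) (𝓝 1) := by
  rw [Metric.tendsto_nhds]
  intro ε hε
  obtain ⟨T, -, hT⟩ := gammaRatio_sub_one_le α (half_pos hε)
  filter_upwards [tendsto_comap.eventually (eventually_ge_atTop T)] with t ht
  rw [dist_eq_norm]
  exact (hT _ (by simp) (by simpa using ht)).trans_lt (half_lt_self hε)

lemma gammaRatio_div_gammaRatio (a b : ℂ) {s : ℂ} (hs : s.im ≠ 0) :
    gammaRatio a s / gammaRatio b s = Complex.Gamma (s + a) / Complex.Gamma (s + b) *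
      Complex.exp ((b - a) * Complex.log s) := by
  have hG := Complex.Gamma_ne_zero (ne_neg_nat_of_im_ne_zero hs)
  rw [gammaRatio, gammaRatio, mul_div_mul_comm, div_div_div_cancel_right₀ hG, ← Complex.exp_sub]
  ring_nf

lemma tendsto_Gamma_div_Gamma (a b : ℂ) :
    Tendsto (fun t : ℝ => Complex.Gamma (Complex.I * t + a) / Complex.Gamma (Complex.I * t + b) *
      Complex.exp ((b - a) * Complex.log (Complex.I * t)))
      (comap (fun t : ℝ => |t|) atTop) (𝓝 1) := by
  have h := (tendsto_gammaRatio a).div (tendsto_gammaRatio b) one_ne_zero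
  rw [div_one] at h
  refine h.congr' ?_
  filter_upwards [tendsto_comap.eventually (eventually_gt_atTop 0)] with t ht
  exact gammaRatio_div_gammaRatio a b (by simpa using ht)

lemma norm_Gamma_div_Gamma_le (a b : ℂ) :
    ∃ T K : ℝ, 1 ≤ T ∧ 0 < K ∧ ∀ s : ℂ, 0 ≤ s.re → T ≤ |s.im| →
      ‖Complex.Gamma (s + a) / Complex.Gamma (s + b)‖ ≤ K * ‖s‖ ^ (a - b).re := by
  obtain ⟨T₁, h₁, hT₁⟩ := gammaRatio_sub_one_le a (half_pos one_pos)
  obtain ⟨T₂, h₂, hT₂⟩ := gammaRatio_sub_one_le b (half_pos one_pos)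
  -- The `3` is `(3/2)/(1/2)` from the two ratios; the exponential absorbs the argument of `s` in
  -- `|s^(a-b)|`.
  refine ⟨max T₁ T₂, 3 * Real.exp (|(a - b).im| * Real.pi), h₁.trans (le_max_left _ _),
    by positivity, fun s hs hT => ?_⟩
  have k1 := hT₁ s hs ((le_max_left _ _).trans hT)
  have k2 := hT₂ s hs ((le_max_right _ _).trans hT)
  have him : s.im ≠ 0 := by
    intro h
    rw [h, abs_zero] at hT
    linarith [le_max_left T₁ T₂]
  have hs0 : s ≠ 0 := by rintro rfl; simp at him
  have e := gammaRatio_div_gammaRatio a b him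
  have e2 : Complex.Gamma (s + a) / Complex.Gamma (s + b) =
      gammaRatio a s / gammaRatio b s * Complex.exp ((a - b) * Complex.log s) := by
    rw [e, mul_assoc, ← Complex.exp_add]
    ring_nf
    simp
  rw [e2, norm_mul, norm_div, Complex.norm_exp, Complex.mul_re, Complex.log_re, Complex.log_im]
  have m1 : ‖gammaRatio a s‖ ≤ 3 / 2 := by
    have := norm_le_norm_add_norm_sub' (gammaRatio a s) 1
    rw [norm_one] at this
    linarith
  have m2 : 1 / 2 ≤ ‖gammaRatio b s‖ := by
    have := norm_le_norm_add_norm_sub (gammaRatio b s) 1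
    rw [norm_one] at this
    linarith
  have m3 : ‖gammaRatio a s‖ / ‖gammaRatio b s‖ ≤ 3 := by
    rw [div_le_iff₀ (by linarith)]; linarith
  have m4 : Real.exp ((a - b).re * Real.log ‖s‖ - (a - b).im * s.arg) ≤
      Real.exp (|(a - b).im| * Real.pi) * ‖s‖ ^ (a - b).re := by
    rw [Real.rpow_def_of_pos (norm_pos_iff.mpr hs0), ← Real.exp_add, Real.exp_le_exp]
    have h3 : -((a - b).im * s.arg) ≤ |(a - b).im| * Real.pi := by
      refine (neg_le_abs _).trans ?_
      rw [abs_mul]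
      gcongr
      exact Complex.abs_arg_le_pi s
    linarith
  calc _ ≤ 3 * (Real.exp (|(a - b).im| * Real.pi) * ‖s‖ ^ (a - b).re) := by gcongr
    _ = _ := by ring

/-! ### Beta integrals on the half line. -/

lemma image_div_one_add : (fun v : ℝ => v / (1 + v)) '' Ioi 0 = Ioo 0 1 := by
  ext x
  constructor
  · rintro ⟨v, hv, rfl⟩
    have hv : 0 < v := hv
    exact ⟨by positivity, by rw [div_lt_one (by positivity)]; linarith⟩
  · rintro ⟨h0, h1⟩
    have : 0 < 1 - x := by linarith
    refine ⟨x / (1 - x), div_pos h0 this, ?_⟩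
    have h2 : 1 + x / (1 - x) = 1 / (1 - x) := by field_simp; ring
    dsimp only
    rw [h2]
    field_simp

lemma hasDerivWithinAt_div_one_add {v : ℝ} (hv : v ∈ Ioi (0 : ℝ)) :
    HasDerivWithinAt (fun v : ℝ => v / (1 + v)) (1 / (1 + v) ^ 2) (Ioi 0) v := by
  have hv : 0 < v := hv
  have h : HasDerivAt (fun v : ℝ => v / (1 + v)) (1 / (1 + v) ^ 2) v := by
    have h1 : 1 + v ≠ 0 := by positivity
    have := (hasDerivAt_id' v).div ((hasDerivAt_id' v).const_add 1) h1
    convert! this using 1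
    ring
  exact h.hasDerivWithinAt

lemma injOn_div_one_add : InjOn (fun v : ℝ => v / (1 + v)) (Ioi 0) := by
  intro x hx y hy h
  have hx : 0 < x := hx
  have hy : 0 < y := hy
  simp only at h
  rw [div_eq_div_iff (by positivity) (by positivity)] at h
  linarith

/-- With `x = v/(1+v)` one has `1 - x = 1/(1+v)` and `dx = dv/(1+v)²`. -/
lemma betaIntegrand_comp_div_one_add (a b : ℂ) {v : ℝ} (hv : 0 < v) :
    |1 / (1 + v) ^ 2| • (((v / (1 + v) : ℝ) : ℂ) ^ (a - 1) *
      (1 - ((v / (1 + v) : ℝ) : ℂ)) ^ (b - 1)) =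
      (v : ℂ) ^ (a - 1) * (1 + (v : ℂ)) ^ (-(a + b)) := by
  have h1 : (0 : ℝ) < 1 + v := by linarith
  have h1c : ((1 + v : ℝ) : ℂ) ≠ 0 := by exact_mod_cast h1.ne'
  have e1 : (1 - ((v / (1 + v) : ℝ) : ℂ)) = (((1 + v)⁻¹ : ℝ) : ℂ) := by
    rw [← Complex.ofReal_one, ← Complex.ofReal_sub]; congr 1; field_simp; ring
  rw [e1, div_eq_mul_inv v, Complex.ofReal_mul,
    Complex.mul_cpow_ofReal_nonneg hv.le (inv_pos.mpr h1).le, abs_of_pos (by positivity),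
    Complex.ofReal_inv, Complex.inv_cpow _ _ (by rw [Complex.arg_ofReal_of_nonneg h1.le]; exact Real.pi_pos.ne),
    Complex.inv_cpow _ _ (by rw [Complex.arg_ofReal_of_nonneg h1.le]; exact Real.pi_pos.ne),
    ← Complex.cpow_neg, ← Complex.cpow_neg, Complex.real_smul]
  have e2 : ((1 / (1 + v) ^ 2 : ℝ) : ℂ) = ((1 + v : ℝ) : ℂ) ^ (-2 : ℂ) := by
    rw [Complex.cpow_neg, one_div]; norm_cast
  have e3 : (1 + (v : ℂ)) = ((1 + v : ℝ) : ℂ) := by push_cast; rfl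
  rw [e2, e3]
  have e4 : -(a + b) = -2 + (-(a - 1) + -(b - 1)) := by ring
  rw [e4, Complex.cpow_add _ _ h1c, Complex.cpow_add _ _ h1c]
  ring

lemma integrableOn_betaIntegrand_Ioi {a b : ℂ} (ha : 0 < a.re) (hb : 0 < b.re) :
    IntegrableOn (fun v : ℝ => (v : ℂ) ^ (a - 1) * (1 + (v : ℂ)) ^ (-(a + b))) (Ioi 0) := by
  have h := Complex.betaIntegral_convergent ha hb
  rw [intervalIntegrable_iff_integrableOn_Ioo_of_le zero_le_one, ← image_div_one_add,
    integrableOn_image_iff_integrableOn_abs_deriv_smul measurableSet_Ioi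
      (fun v hv => hasDerivWithinAt_div_one_add hv) injOn_div_one_add] at h
  exact h.congr_fun (fun v hv => betaIntegrand_comp_div_one_add a b hv) measurableSet_Ioi

lemma integral_betaIntegrand_Ioi {a b : ℂ} (ha : 0 < a.re) (hb : 0 < b.re) :
    ∫ v in Ioi (0 : ℝ), (v : ℂ) ^ (a - 1) * (1 + (v : ℂ)) ^ (-(a + b)) =
      Complex.Gamma a * Complex.Gamma b / Complex.Gamma (a + b) := by
  rw [← Complex.betaIntegral_eq_Gamma_mul_div a b ha hb, Complex.betaIntegral,
    intervalIntegral.integral_of_le zero_le_one, integral_Ioc_eq_integral_Ioo, ← image_div_one_add,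
    integral_image_eq_integral_abs_deriv_smul measurableSet_Ioi
      (fun v hv => hasDerivWithinAt_div_one_add hv) injOn_div_one_add]
  exact setIntegral_congr_fun measurableSet_Ioi
    fun v hv => (betaIntegrand_comp_div_one_add a b hv).symm

/-! ### Mellin integrals of products of two Laplace transforms. -/

/-- The algebraic kernel `v ^ (a - 1) * (1 + v) ^ (d - 1)`. -/
noncomputable def eulerKernel (a d : ℂ) (v : ℝ) : ℂ := (v : ℂ) ^ (a - 1) * (1 + (v : ℂ)) ^ (d - 1)

lemma measurable_eulerKernel (a d : ℂ) : Measurable (eulerKernel a d) := by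
  unfold eulerKernel
  fun_prop

lemma norm_one_add_cpow {v : ℝ} (hv : 0 < v) (w : ℂ) : ‖(1 + (v : ℂ)) ^ w‖ = (1 + v) ^ w.re := by
  have e3 : (1 + (v : ℂ)) = ((1 + v : ℝ) : ℂ) := by push_cast; rfl
  rw [e3, Complex.norm_cpow_eq_rpow_re_of_pos (by linarith)]

lemma norm_eulerKernel (a d : ℂ) {v : ℝ} (hv : 0 < v) :
    ‖eulerKernel a d v‖ = v ^ (a.re - 1) * (1 + v) ^ (d.re - 1) := by
  rw [eulerKernel, norm_mul, Complex.norm_cpow_eq_rpow_re_of_pos hv, norm_one_add_cpow hv]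
  simp

lemma integrableOn_norm_eulerKernel_mul_rpow {a d : ℂ} {e : ℝ} (ha : 0 < a.re)
    (h : a.re + d.re - 1 < e) :
    IntegrableOn (fun v : ℝ => ‖eulerKernel a d v‖ * (1 + v) ^ (-e)) (Ioi 0) := by
  have h1 := (integrableOn_betaIntegrand_Ioi (a := a) (b := ((1 - d.re - a.re + e : ℝ) : ℂ)) ha
    (by rw [Complex.ofReal_re]; linarith)).norm
  refine IntegrableOn.congr_fun h1 (fun v hv => ?_) measurableSet_Ioi
  have hv : 0 < v := hv
  rw [norm_eulerKernel a d hv, norm_mul, Complex.norm_cpow_eq_rpow_re_of_pos hv,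
    norm_one_add_cpow hv, mul_assoc, ← Real.rpow_add (by linarith)]
  congr 2
  simp
  ring

/-- Identifies one variable's share of the `n`-th term of the expansion as a half-line Beta
integrand with parameters `a + n` and `c + 1 - a - d`. -/
lemma eulerKernel_mul_pow (a d c : ℂ) (n : ℕ) {v : ℝ} (hv : 0 < v) :
    eulerKernel a d v * (1 + (v : ℂ)) ^ (-c) * ((v : ℂ) / (1 + v)) ^ n =
      (v : ℂ) ^ (a + n - 1) * (1 + (v : ℂ)) ^ (-(a + n + (c + 1 - a - d))) := by
  have hv0 : (v : ℂ) ≠ 0 := by exact_mod_cast hv.ne'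
  have h1 : (1 + (v : ℂ)) ≠ 0 := by
    have : (1 + v : ℝ) ≠ 0 := by linarith
    exact_mod_cast this
  have e1 : a + n - 1 = (a - 1) + n := by ring
  have e2 : -(a + n + (c + 1 - a - d)) = (d - 1) + (-c) - n := by ring
  rw [e1, e2, Complex.cpow_add _ _ hv0, Complex.cpow_sub _ _ h1, Complex.cpow_add _ _ h1,
    Complex.cpow_natCast, Complex.cpow_natCast, eulerKernel, div_pow]
  ring

section Product

variable {c a₁ d₁ a₂ d₂ : ℂ} {θ : ℝ}

/-- The parameter `θ` distributes the decay of `(1+v+x)^(-Re c)`: it is at most `(1+v)^(-(1-θ) Re c)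
(1+x)^(-θ Re c)`, which leaves two independent integrals. -/
lemma integrable_eulerKernel_mul_rpow (hc : 0 < c.re) (ha₁ : 0 < a₁.re) (ha₂ : 0 < a₂.re)
    (h0 : 0 ≤ θ) (h1 : θ ≤ 1) (hd₁ : a₁.re + d₁.re - 1 < c.re * (1 - θ))
    (hd₂ : a₂.re + d₂.re - 1 < c.re * θ) :
    Integrable (fun q : ℝ × ℝ => (1 + q.1 + q.2) ^ (-c.re) *
      (‖eulerKernel a₁ d₁ q.1‖ * ‖eulerKernel a₂ d₂ q.2‖))
      ((volume.restrict (Ioi 0)).prod (volume.restrict (Ioi 0))) := by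
  have hI := (integrableOn_norm_eulerKernel_mul_rpow ha₁ hd₁).integrable.mul_prod
    (integrableOn_norm_eulerKernel_mul_rpow ha₂ hd₂).integrable
  refine hI.mono' ?_ ?_
  · have m1 := measurable_eulerKernel a₁ d₁
    have m2 := measurable_eulerKernel a₂ d₂
    refine Measurable.aestronglyMeasurable ?_
    fun_prop
  · rw [Measure.prod_restrict, ae_restrict_iff' (measurableSet_Ioi.prod measurableSet_Ioi)]
    refine ae_of_all _ fun q hq => ?_
    have hv : 0 < q.1 := hq.1
    have hx : 0 < q.2 := hq.2
    have hs : 0 < 1 + q.1 + q.2 := by positivity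
    rw [Real.norm_of_nonneg (by positivity)]
    have e : (1 + q.1 + q.2) ^ (-c.re) =
        (1 + q.1 + q.2) ^ (-(c.re * (1 - θ))) * (1 + q.1 + q.2) ^ (-(c.re * θ)) := by
      rw [← Real.rpow_add hs]; ring_nf
    have i1 : (1 + q.1 + q.2) ^ (-(c.re * (1 - θ))) ≤ (1 + q.1) ^ (-(c.re * (1 - θ))) :=
      Real.rpow_le_rpow_of_nonpos (by positivity) (by linarith)
        (neg_nonpos.mpr (mul_nonneg hc.le (by linarith)))
    have i2 : (1 + q.1 + q.2) ^ (-(c.re * θ)) ≤ (1 + q.2) ^ (-(c.re * θ)) :=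
      Real.rpow_le_rpow_of_nonpos (by positivity) (by linarith)
        (neg_nonpos.mpr (mul_nonneg hc.le h0))
    rw [e]
    calc _ ≤ ((1 + q.1) ^ (-(c.re * (1 - θ))) * (1 + q.2) ^ (-(c.re * θ))) *
        (‖eulerKernel a₁ d₁ q.1‖ * ‖eulerKernel a₂ d₂ q.2‖) := by gcongr
      _ = _ := by ring

/-- The integrand whose `y`-marginal is the Mellin integrand of a product of two Laplace
transforms. -/
noncomputable def laplaceKernel (c a₁ d₁ a₂ d₂ : ℂ) (q : ℝ × ℝ × ℝ) : ℂ :=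
  (q.1 : ℂ) ^ (c - 1) * Complex.exp (-((1 + q.2.1 + q.2.2 : ℂ) * q.1)) *
    (eulerKernel a₁ d₁ q.2.1 * eulerKernel a₂ d₂ q.2.2)

lemma norm_laplaceKernel {q : ℝ × ℝ × ℝ} (hq : 0 < q.1) :
    ‖laplaceKernel c a₁ d₁ a₂ d₂ q‖ = q.1 ^ (c.re - 1) * Real.exp (-((1 + q.2.1 + q.2.2) * q.1)) *
      (‖eulerKernel a₁ d₁ q.2.1‖ * ‖eulerKernel a₂ d₂ q.2.2‖) := by
  rw [laplaceKernel, norm_mul, norm_mul, norm_mul, Complex.norm_cpow_eq_rpow_re_of_pos hq,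
    Complex.norm_exp]
  have : (-((1 + q.2.1 + q.2.2 : ℂ) * q.1)).re = -((1 + q.2.1 + q.2.2) * q.1) := by
    rw [← Complex.ofReal_re (-((1 + q.2.1 + q.2.2) * q.1))]; push_cast; rfl
  rw [this]
  simp

/-- By Tonelli: the `y`-integral of the absolute value is `Γ(Re c) (1+v+x)^(-Re c)` times the norms
of the kernels. -/
lemma integrable_laplaceKernel (hc : 0 < c.re) (ha₁ : 0 < a₁.re) (ha₂ : 0 < a₂.re)
    (h0 : 0 ≤ θ) (h1 : θ ≤ 1) (hd₁ : a₁.re + d₁.re - 1 < c.re * (1 - θ))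
    (hd₂ : a₂.re + d₂.re - 1 < c.re * θ) :
    Integrable (laplaceKernel c a₁ d₁ a₂ d₂) ((volume.restrict (Ioi 0)).prod
      ((volume.restrict (Ioi 0)).prod (volume.restrict (Ioi 0)))) := by
  have m1 := measurable_eulerKernel a₁ d₁
  have m2 := measurable_eulerKernel a₂ d₂
  have hm : Measurable (laplaceKernel c a₁ d₁ a₂ d₂) := by
    unfold laplaceKernel
    fun_prop
  have hpos : ∀ᵐ q : ℝ × ℝ ∂((volume.restrict (Ioi 0)).prod (volume.restrict (Ioi 0))),
      0 < q.1 ∧ 0 < q.2 := by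
    rw [Measure.prod_restrict, ae_restrict_iff' (measurableSet_Ioi.prod measurableSet_Ioi)]
    exact ae_of_all _ fun q hq => hq
  rw [integrable_prod_iff' hm.aestronglyMeasurable]
  constructor
  · filter_upwards [hpos] with q hq
    have hs : 0 < 1 + q.1 + q.2 := by linarith [hq.1, hq.2]
    have h := (integrableOn_rpow_mul_exp_neg_mul_rpow (s := c.re - 1) (p := 1) (by linarith) one_pos
      hs).mul_const (‖eulerKernel a₁ d₁ q.1‖ * ‖eulerKernel a₂ d₂ q.2‖)
    refine (integrable_norm_iff (hm.comp measurable_prodMk_right).aestronglyMeasurable).mp ?_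
    refine IntegrableOn.congr_fun h (fun y hy => ?_) measurableSet_Ioi
    simp only [Function.comp]
    rw [norm_laplaceKernel (q := (y, q)) hy, Real.rpow_one, neg_mul]
  · have h := (integrable_eulerKernel_mul_rpow hc ha₁ ha₂ h0 h1 hd₁ hd₂).const_mul
      (Real.Gamma c.re)
    refine h.congr ?_
    filter_upwards [hpos] with q hq
    have hs : 0 < 1 + q.1 + q.2 := by linarith [hq.1, hq.2]
    have e : ∫ y in Ioi (0 : ℝ), ‖laplaceKernel c a₁ d₁ a₂ d₂ (y, q)‖ =
        ∫ y in Ioi (0 : ℝ), y ^ (c.re - 1) * Real.exp (-((1 + q.1 + q.2) * y)) *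
          (‖eulerKernel a₁ d₁ q.1‖ * ‖eulerKernel a₂ d₂ q.2‖) :=
      setIntegral_congr_fun measurableSet_Ioi fun y hy => norm_laplaceKernel (q := (y, q)) hy
    rw [e, integral_mul_const, Real.integral_rpow_mul_exp_neg_mul_Ioi hc hs, one_div,
      Real.inv_rpow hs.le, ← Real.rpow_neg hs.le]
    ring

/-- The Laplace transform of `eulerKernel`. -/
noncomputable def eulerLaplace (a d : ℂ) (y : ℝ) : ℂ :=
  ∫ v in Ioi (0 : ℝ), Complex.exp (-((y : ℂ) * (v : ℂ))) * eulerKernel a d v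

lemma integral_laplaceKernel (y : ℝ) :
    ∫ q, laplaceKernel c a₁ d₁ a₂ d₂ (y, q)
      ∂((volume.restrict (Ioi 0)).prod (volume.restrict (Ioi 0))) =
    (y : ℂ) ^ (c - 1) * Complex.exp (-(y : ℂ)) * (eulerLaplace a₁ d₁ y * eulerLaplace a₂ d₂ y) := by
  rw [eulerLaplace, eulerLaplace, ← integral_prod_mul, ← integral_const_mul]
  congr 1
  ext q
  have : Complex.exp (-((1 + q.1 + q.2 : ℂ) * y)) = Complex.exp (-(y : ℂ)) *
      (Complex.exp (-((y : ℂ) * q.1)) * Complex.exp (-((y : ℂ) * q.2))) := by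
    rw [← Complex.exp_add, ← Complex.exp_add]; ring_nf
  rw [laplaceKernel, this]
  ring

lemma integrableOn_eulerLaplace_mul (hc : 0 < c.re) (ha₁ : 0 < a₁.re) (ha₂ : 0 < a₂.re)
    (h0 : 0 ≤ θ) (h1 : θ ≤ 1) (hd₁ : a₁.re + d₁.re - 1 < c.re * (1 - θ))
    (hd₂ : a₂.re + d₂.re - 1 < c.re * θ) :
    IntegrableOn (fun y : ℝ => (y : ℂ) ^ (c - 1) * Complex.exp (-(y : ℂ)) *
      (eulerLaplace a₁ d₁ y * eulerLaplace a₂ d₂ y)) (Ioi 0) := by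
  have h := (integrable_laplaceKernel hc ha₁ ha₂ h0 h1 hd₁ hd₂).integral_prod_left
  simp only [integral_laplaceKernel] at h
  exact h

lemma integral_laplaceKernel_left (hc : 0 < c.re) {q : ℝ × ℝ} (hq : 0 < 1 + q.1 + q.2) :
    ∫ y in Ioi (0 : ℝ), laplaceKernel c a₁ d₁ a₂ d₂ (y, q) = Complex.Gamma c *
      ((1 + q.1 + q.2 : ℝ) : ℂ) ^ (-c) * (eulerKernel a₁ d₁ q.1 * eulerKernel a₂ d₂ q.2) := by
  simp only [laplaceKernel]
  rw [integral_mul_const]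
  have h := Complex.integral_cpow_mul_exp_neg_mul_Ioi (a := c) (r := 1 + q.1 + q.2) hc hq
  rw [one_div, Complex.inv_cpow _ _ (by
    rw [Complex.arg_ofReal_of_nonneg hq.le]
    exact Real.pi_pos.ne), ← Complex.cpow_neg] at h
  push_cast at h ⊢
  rw [h]
  ring

lemma one_sub_div_mul_div {v x : ℝ} (hv : 0 < v) (hx : 0 < x) :
    (1 + v) * (1 + x) * (1 - v / (1 + v) * (x / (1 + x))) = 1 + v + x := by
  field_simp
  ring

lemma div_mul_div_lt_one {v x : ℝ} (hv : 0 < v) (hx : 0 < x) :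
    v / (1 + v) * (x / (1 + x)) < 1 := by
  have h1 : v / (1 + v) < 1 := by rw [div_lt_one (by positivity)]; linarith
  have h2 : x / (1 + x) < 1 := by rw [div_lt_one (by positivity)]; linarith
  have h3 : 0 ≤ x / (1 + x) := by positivity
  nlinarith

/-- Mellin integral of a product of two Laplace transforms of `eulerKernel`s as a hypergeometric
series. -/
lemma hasSum_integral_eulerLaplace_mul (hc : 0 < c.re) (ha₁ : 0 < a₁.re) (ha₂ : 0 < a₂.re)
    (h0 : 0 ≤ θ) (h1 : θ ≤ 1) (hd₁ : a₁.re + d₁.re - 1 < c.re * (1 - θ))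
    (hd₂ : a₂.re + d₂.re - 1 < c.re * θ) :
    HasSum (fun n : ℕ => Complex.Gamma c * risingCoeff c n *
      ((Complex.Gamma (a₁ + n) * Complex.Gamma (c + 1 - a₁ - d₁) /
          Complex.Gamma (a₁ + n + (c + 1 - a₁ - d₁))) *
        (Complex.Gamma (a₂ + n) * Complex.Gamma (c + 1 - a₂ - d₂) /
          Complex.Gamma (a₂ + n + (c + 1 - a₂ - d₂)))))
      (∫ y in Ioi (0 : ℝ), (y : ℂ) ^ (c - 1) * Complex.exp (-(y : ℂ)) *
        (eulerLaplace a₁ d₁ y * eulerLaplace a₂ d₂ y)) := by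
  have m1 := measurable_eulerKernel a₁ d₁
  have m2 := measurable_eulerKernel a₂ d₂
  have hpos : ∀ᵐ q : ℝ × ℝ ∂((volume.restrict (Ioi 0)).prod (volume.restrict (Ioi 0))),
      0 < q.1 ∧ 0 < q.2 := by
    rw [Measure.prod_restrict, ae_restrict_iff' (measurableSet_Ioi.prod measurableSet_Ioi)]
    exact ae_of_all _ fun q hq => hq
  obtain ⟨K, hK, hKr⟩ := exists_norm_risingCoeff_le_re hc
  set g : ℂ → ℂ → ℕ → ℝ → ℂ := fun a d n v =>
    eulerKernel a d v * (1 + (v : ℂ)) ^ (-c) * ((v : ℂ) / (1 + v)) ^ n with hg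
  have hgint : ∀ (a d : ℂ) (n : ℕ), 0 < a.re → 0 < c.re + 1 - a.re - d.re →
      ∫ v in Ioi (0 : ℝ), g a d n v = Complex.Gamma (a + n) * Complex.Gamma (c + 1 - a - d) /
          Complex.Gamma (a + n + (c + 1 - a - d)) := by
    intro a d n ha hb
    rw [← integral_betaIntegrand_Ioi (by simp; positivity) (by simpa using hb)]
    exact setIntegral_congr_fun measurableSet_Ioi fun v hv => eulerKernel_mul_pow a d c n hv
  have hb₁ : 0 < c.re + 1 - a₁.re - d₁.re := by nlinarith
  have hb₂ : 0 < c.re + 1 - a₂.re - d₂.re := by nlinarith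
  have hswap : (∫ y in Ioi (0 : ℝ), (y : ℂ) ^ (c - 1) * Complex.exp (-(y : ℂ)) *
        (eulerLaplace a₁ d₁ y * eulerLaplace a₂ d₂ y)) =
      ∫ q : ℝ × ℝ, Complex.Gamma c * ((1 + q.1 + q.2 : ℝ) : ℂ) ^ (-c) *
        (eulerKernel a₁ d₁ q.1 * eulerKernel a₂ d₂ q.2)
        ∂((volume.restrict (Ioi 0)).prod (volume.restrict (Ioi 0))) := by
    simp only [← integral_laplaceKernel]
    rw [integral_integral_swap (f := fun y q => laplaceKernel c a₁ d₁ a₂ d₂ (y, q))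
      (integrable_laplaceKernel hc ha₁ ha₂ h0 h1 hd₁ hd₂)]
    refine integral_congr_ae ?_
    filter_upwards [hpos] with q hq
    exact integral_laplaceKernel_left hc (by linarith [hq.1, hq.2])
  have hF : ∀ n : ℕ, Complex.Gamma c * risingCoeff c n *
      ((Complex.Gamma (a₁ + n) * Complex.Gamma (c + 1 - a₁ - d₁) /
          Complex.Gamma (a₁ + n + (c + 1 - a₁ - d₁))) *
        (Complex.Gamma (a₂ + n) * Complex.Gamma (c + 1 - a₂ - d₂) /
          Complex.Gamma (a₂ + n + (c + 1 - a₂ - d₂)))) =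
      ∫ q : ℝ × ℝ, Complex.Gamma c * risingCoeff c n * (g a₁ d₁ n q.1 * g a₂ d₂ n q.2)
        ∂((volume.restrict (Ioi 0)).prod (volume.restrict (Ioi 0))) := by
    intro n
    rw [integral_const_mul, integral_prod_mul (g a₁ d₁ n) (g a₂ d₂ n), hgint a₁ d₁ n ha₁ hb₁,
      hgint a₂ d₂ n ha₂ hb₂]
  rw [hswap]
  simp only [hF]
  -- The termwise majorant sums back to a multiple of `(1+v+x)^(-Re c)` times the kernel norms,
  -- already known to be integrable.
  have hsum : ∀ q : ℝ × ℝ, 0 < q.1 ∧ 0 < q.2 →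
      HasSum (fun n => ‖Complex.Gamma c‖ * K * (((1 + q.1) * (1 + q.2)) ^ (-c.re) *
        (‖eulerKernel a₁ d₁ q.1‖ * ‖eulerKernel a₂ d₂ q.2‖)) *
        (‖risingCoeff (c.re : ℂ) n‖ * (q.1 / (1 + q.1) * (q.2 / (1 + q.2))) ^ n))
      (‖Complex.Gamma c‖ * K * ((1 + q.1 + q.2) ^ (-c.re) *
        (‖eulerKernel a₁ d₁ q.1‖ * ‖eulerKernel a₂ d₂ q.2‖))) := by
    intro q hq
    obtain ⟨hv, hx⟩ := hq
    have h := (hasSum_norm_risingCoeff hc (z := q.1 / (1 + q.1) * (q.2 / (1 + q.2)))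
      (by positivity) (div_mul_div_lt_one hv hx)).mul_left (‖Complex.Gamma c‖ * K *
        (((1 + q.1) * (1 + q.2)) ^ (-c.re) *
        (‖eulerKernel a₁ d₁ q.1‖ * ‖eulerKernel a₂ d₂ q.2‖)))
    have hz := div_mul_div_lt_one hv hx
    have e : (1 + q.1 + q.2) ^ (-c.re) = ((1 + q.1) * (1 + q.2)) ^ (-c.re) *
        (1 - q.1 / (1 + q.1) * (q.2 / (1 + q.2))) ^ (-c.re) := by
      rw [← Real.mul_rpow (by positivity) (by linarith), one_sub_div_mul_div hv hx]
    rw [e]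
    convert! h using 1
    ring
  refine hasSum_integral_of_dominated_convergence
    (fun n q => ‖Complex.Gamma c‖ * K * (((1 + q.1) * (1 + q.2)) ^ (-c.re) *
        (‖eulerKernel a₁ d₁ q.1‖ * ‖eulerKernel a₂ d₂ q.2‖)) *
        (‖risingCoeff (c.re : ℂ) n‖ * (q.1 / (1 + q.1) * (q.2 / (1 + q.2))) ^ n))
    (fun n => ?_) (fun n => ?_) ?_ ?_ ?_
  · refine Measurable.aestronglyMeasurable ?_
    simp only [hg]
    fun_prop
  · filter_upwards [hpos] with q hq
    obtain ⟨hv, hx⟩ := hq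
    have hnorm : ∀ (a d : ℂ) {v : ℝ}, 0 < v → ‖g a d n v‖ =
        ‖eulerKernel a d v‖ * (1 + v) ^ (-c.re) * (v / (1 + v)) ^ n := by
      intro a d v hv
      have e : (v : ℂ) / (1 + v) = ((v / (1 + v) : ℝ) : ℂ) := by push_cast; rfl
      simp only [hg]
      rw [norm_mul, norm_mul, norm_one_add_cpow hv, norm_pow, e, Complex.norm_real,
        Real.norm_of_nonneg (by positivity), Complex.neg_re]
    rw [norm_mul, norm_mul, norm_mul, hnorm _ _ hv, hnorm _ _ hx,
      Real.mul_rpow (by positivity) (by positivity), mul_pow]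
    calc _ ≤ ‖Complex.Gamma c‖ * (K * ‖risingCoeff (c.re : ℂ) n‖) *
        (‖eulerKernel a₁ d₁ q.1‖ * (1 + q.1) ^ (-c.re) * (q.1 / (1 + q.1)) ^ n *
          (‖eulerKernel a₂ d₂ q.2‖ * (1 + q.2) ^ (-c.re) * (q.2 / (1 + q.2)) ^ n)) := by
          gcongr
          exact hKr n
      _ = _ := by ring
  · filter_upwards [hpos] with q hq
    exact (hsum q hq).summable
  · refine ((integrable_eulerKernel_mul_rpow hc ha₁ ha₂ h0 h1 hd₁ hd₂).const_mul
      (‖Complex.Gamma c‖ * K)).congr ?_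
    filter_upwards [hpos] with q hq
    exact (hsum q hq).tsum_eq.symm
  · filter_upwards [hpos] with q hq
    obtain ⟨hv, hx⟩ := hq
    have hz := div_mul_div_lt_one hv hx
    have h := (hasSum_risingCoeff c (z := ((q.1 / (1 + q.1) * (q.2 / (1 + q.2)) : ℝ) : ℂ))
      (by rwa [Complex.norm_real, Real.norm_of_nonneg (by positivity)])).mul_left
      (Complex.Gamma c * ((1 + (q.1 : ℂ)) ^ (-c) * (1 + (q.2 : ℂ)) ^ (-c)) *
        (eulerKernel a₁ d₁ q.1 * eulerKernel a₂ d₂ q.2))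
    have e1 : ((1 + q.1 + q.2 : ℝ) : ℂ) ^ (-c) = (1 + (q.1 : ℂ)) ^ (-c) * (1 + (q.2 : ℂ)) ^ (-c) *
        (1 - ((q.1 / (1 + q.1) * (q.2 / (1 + q.2)) : ℝ) : ℂ)) ^ (-c) := by
      rw [← one_sub_div_mul_div hv hx, Complex.ofReal_mul,
        Complex.mul_cpow_ofReal_nonneg (by positivity) (by linarith), Complex.ofReal_mul,
        Complex.mul_cpow_ofReal_nonneg (by positivity) (by positivity)]
      push_cast
      rfl
    convert! h using 1
    · ext n
      push_cast
      ring
    · rw [e1]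
      ring

end Product

/-! ### The alternating sum of differences of squared coefficients. -/

/-- The differences of consecutive squares of `risingCoeff c`. -/
noncomputable def risingSqDiff (c : ℂ) : ℕ → ℂ
  | 0 => 1
  | n + 1 => risingCoeff c (n + 1) ^ 2 - risingCoeff c n ^ 2

lemma risingCoeff_succ_sub (c : ℂ) (n : ℕ) :
    risingCoeff c (n + 1) - risingCoeff c n = risingCoeff c n * ((c - 1) / (n + 1)) := by
  have : (n : ℂ) + 1 ≠ 0 := by exact_mod_cast n.succ_ne_zero
  rw [risingCoeff_succ]
  field_simp
  ring

lemma norm_natCast_add_one (n : ℕ) : ‖(n : ℂ) + 1‖ = n + 1 := by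
  exact_mod_cast Complex.norm_natCast (n + 1)

lemma norm_risingCoeff_succ_sub (c : ℂ) (n : ℕ) :
    ‖risingCoeff c (n + 1) - risingCoeff c n‖ = ‖risingCoeff c n‖ * (‖c - 1‖ / (n + 1)) := by
  rw [risingCoeff_succ_sub, norm_mul, norm_div, norm_natCast_add_one]

lemma rpow_succ_le {e : ℝ} (he : e ≤ 0) (n : ℕ) :
    ((n : ℝ) + 1) ^ e ≤ 2 ^ (-e) * (((n + 1 : ℕ) : ℝ) + 1) ^ e := by
  have h1 : (((n + 1 : ℕ) : ℝ) + 1) / 2 ≤ (n : ℝ) + 1 := by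
    push_cast
    have : (0 : ℝ) ≤ n := n.cast_nonneg
    linarith
  refine (Real.rpow_le_rpow_of_nonpos (by positivity) h1 he).trans ?_
  rw [Real.div_rpow (by positivity) (by positivity), Real.rpow_neg (by positivity)]
  apply le_of_eq
  field_simp

lemma exists_norm_risingCoeff_succ_le {c : ℂ} (h0 : 0 < c.re) (h1 : c.re < 1) :
    ∃ K : ℝ, 0 < K ∧ ∀ n : ℕ, ‖risingCoeff c n‖ ≤ K * ((n : ℝ) + 1) ^ (c.re - 1) ∧
      ‖risingCoeff c (n + 1)‖ ≤ K * ((n : ℝ) + 1) ^ (c.re - 1) := by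
  obtain ⟨K, hK, hr⟩ := exists_norm_risingCoeff_le h0
  refine ⟨K, hK, fun n => ⟨hr n, (hr (n + 1)).trans ?_⟩⟩
  have hn : (0 : ℝ) < (n : ℝ) + 1 := by positivity
  have : (((n + 1 : ℕ) : ℝ) + 1) ^ (c.re - 1) ≤ ((n : ℝ) + 1) ^ (c.re - 1) :=
    Real.rpow_le_rpow_of_nonpos hn (by push_cast; linarith) (by linarith)
  gcongr

lemma rpow_mul_rpow_div {x : ℝ} (hx : 0 < x) (σ : ℝ) :
    x ^ (σ - 1) * x ^ (σ - 1) / x = x ^ (2 * σ - 3) := by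
  rw [← Real.rpow_add hx, ← Real.rpow_sub_one hx.ne']
  ring_nf

lemma exists_norm_risingSqDiff_le {c : ℂ} (h0 : 0 < c.re) (h1 : c.re < 1) :
    ∃ K : ℝ, 0 < K ∧ ∀ n : ℕ, ‖risingSqDiff c n‖ ≤ K * ((n : ℝ) + 1) ^ (2 * c.re - 3) := by
  obtain ⟨K, hK, hr⟩ := exists_norm_risingCoeff_succ_le h0 h1
  refine ⟨1 + 2 * K ^ 2 * ‖c - 1‖ * 2 ^ (-(2 * c.re - 3)), by positivity, fun n => ?_⟩
  rcases n with _ | n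
  · have : 0 ≤ 2 * K ^ 2 * ‖c - 1‖ * 2 ^ (-(2 * c.re - 3)) := by positivity
    simpa [risingSqDiff] using this
  · have hn : (0 : ℝ) < (n : ℝ) + 1 := by positivity
    have e : risingSqDiff c (n + 1) = (risingCoeff c (n + 1) - risingCoeff c n) *
        (risingCoeff c (n + 1) + risingCoeff c n) := by
      rw [risingSqDiff]; ring
    have b1 : ‖risingCoeff c (n + 1) + risingCoeff c n‖ ≤ 2 * K * ((n : ℝ) + 1) ^ (c.re - 1) := by
      have k4 := norm_add_le (risingCoeff c (n + 1)) (risingCoeff c n)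
      linarith [(hr n).1, (hr n).2]
    have b2 : ‖risingSqDiff c (n + 1)‖ ≤
        2 * K ^ 2 * ‖c - 1‖ * ((n : ℝ) + 1) ^ (2 * c.re - 3) := by
      rw [e, norm_mul, norm_risingCoeff_succ_sub]
      rw [← rpow_mul_rpow_div hn]
      calc _ ≤ (K * ((n : ℝ) + 1) ^ (c.re - 1)) * (‖c - 1‖ / (n + 1)) *
          (2 * K * ((n : ℝ) + 1) ^ (c.re - 1)) := by gcongr; exact (hr n).1
        _ = _ := by ring
    refine b2.trans ?_
    have b3 := rpow_succ_le (e := 2 * c.re - 3) (by linarith) n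
    have b4 : 0 ≤ (((n + 1 : ℕ) : ℝ) + 1) ^ (2 * c.re - 3) := by positivity
    calc _ ≤ 2 * K ^ 2 * ‖c - 1‖ *
        (2 ^ (-(2 * c.re - 3)) * (((n + 1 : ℕ) : ℝ) + 1) ^ (2 * c.re - 3)) := by gcongr
      _ ≤ _ := by rw [add_mul, one_mul, ← mul_assoc]; linarith

lemma summable_add_one_rpow {e : ℝ} (he : e < -1) : Summable fun n : ℕ => ((n : ℝ) + 1) ^ e := by
  have := (summable_nat_add_iff 1).mpr (Real.summable_nat_rpow.mpr he)
  simpa using this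

lemma integrableOn_betaIntegrand {a b : ℂ} (ha : 0 < a.re) (hb : 0 < b.re) :
    IntegrableOn (fun x : ℝ => (x : ℂ) ^ (a - 1) * (1 - (x : ℂ)) ^ (b - 1)) (Ioo 0 1) := by
  have h := Complex.betaIntegral_convergent ha hb
  rwa [intervalIntegrable_iff_integrableOn_Ioo_of_le zero_le_one] at h

lemma integral_betaIntegrand {a b : ℂ} (ha : 0 < a.re) (hb : 0 < b.re) :
    ∫ x in Ioo (0 : ℝ) 1, (x : ℂ) ^ (a - 1) * (1 - (x : ℂ)) ^ (b - 1) =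
      Complex.Gamma a * Complex.Gamma b / Complex.Gamma (a + b) := by
  rw [← Complex.betaIntegral_eq_Gamma_mul_div a b ha hb, Complex.betaIntegral,
    intervalIntegral.integral_of_le zero_le_one, integral_Ioc_eq_integral_Ioo]

lemma norm_betaIntegrand (a b : ℂ) {x : ℝ} (hx : x ∈ Ioo (0 : ℝ) 1) :
    ‖(x : ℂ) ^ (a - 1) * (1 - (x : ℂ)) ^ (b - 1)‖ = x ^ (a.re - 1) * (1 - x) ^ (b.re - 1) := by
  have e : (1 - (x : ℂ)) = ((1 - x : ℝ) : ℂ) := by push_cast; rfl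
  rw [norm_mul, e, Complex.norm_cpow_eq_rpow_re_of_pos hx.1,
    Complex.norm_cpow_eq_rpow_re_of_pos (by linarith [hx.2])]
  simp

lemma integral_norm_betaIntegrand {a b : ℂ} (ha : 0 < a.re) (hb : 0 < b.re) :
    ∫ x in Ioo (0 : ℝ) 1, ‖(x : ℂ) ^ (a - 1) * (1 - (x : ℂ)) ^ (b - 1)‖ =
      Real.Gamma a.re * Real.Gamma b.re / Real.Gamma (a.re + b.re) := by
  have h := integral_betaIntegrand (a := (a.re : ℂ)) (b := (b.re : ℂ)) (by simpa) (by simpa)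
  rw [← Complex.ofReal_add, Complex.Gamma_ofReal, Complex.Gamma_ofReal, Complex.Gamma_ofReal] at h
  apply Complex.ofReal_injective
  rw [← integral_complex_ofReal]
  push_cast at h ⊢
  rw [← h]
  refine setIntegral_congr_fun measurableSet_Ioo fun x hx => ?_
  have hx1 : 0 ≤ 1 - x := by linarith [hx.2]
  rw [norm_betaIntegrand a b hx, Complex.ofReal_mul, Complex.ofReal_cpow hx.1.le,
    Complex.ofReal_cpow hx1]
  push_cast
  rfl

lemma integral_betaIntegrand_eq_risingCoeff {c : ℂ} (h0 : 0 < c.re) (h1 : c.re < 1) (n : ℕ) :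
    ∫ x in Ioo (0 : ℝ) 1, (x : ℂ) ^ (c + n - 1) * (1 - (x : ℂ)) ^ (1 - c - 1) =
      Complex.Gamma c * Complex.Gamma (1 - c) * risingCoeff c n := by
  rw [integral_betaIntegrand (by simp; positivity) (by simpa using h1),
    Gamma_add_nat_eq_risingCoeff (ne_neg_nat_of_re_pos h0)]
  have e : c + n + (1 - c) = n + 1 := by ring
  have hf : (n.factorial : ℂ) ≠ 0 := by exact_mod_cast n.factorial_ne_zero
  rw [e, Complex.Gamma_nat_eq_factorial]
  field_simp

/-- The substitution `y = x²` applies because `(1+x)^(-c) (1-x)^(-c) = (1-x²)^(-c)`. -/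
lemma integral_betaIntegrand_mul_add_cpow {c : ℂ} (h0 : 0 < c.re) (h1 : c.re < 1) :
    ∫ x in Ioo (0 : ℝ) 1, 2 * (1 + (x : ℂ)) ^ (-c) *
      ((x : ℂ) ^ (c - 1) * (1 - (x : ℂ)) ^ (1 - c - 1)) =
      Complex.Gamma (c / 2) * Complex.Gamma (1 - c) / Complex.Gamma (c / 2 + (1 - c)) := by
  have hc2 : 0 < (c / 2).re := by
    have : (c / 2).re = c.re / 2 := by simp
    rw [this]; positivity
  rw [← integral_betaIntegrand hc2 (by simpa using h1)]
  have him : (fun x : ℝ => x ^ 2) '' Ioo 0 1 = Ioo 0 1 := by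
    ext y
    constructor
    · rintro ⟨x, hx, rfl⟩
      exact ⟨pow_pos hx.1 2, pow_lt_one₀ hx.1.le hx.2 two_ne_zero⟩
    · intro hy
      refine ⟨√y, ⟨Real.sqrt_pos.mpr hy.1, ?_⟩, Real.sq_sqrt hy.1.le⟩
      rw [Real.sqrt_lt' one_pos]
      simpa using hy.2
  have hinj : InjOn (fun x : ℝ => x ^ 2) (Ioo 0 1) := fun x hx y hy h =>
    (pow_left_inj₀ hx.1.le hy.1.le two_ne_zero).mp h
  conv_rhs => rw [← him, integral_image_eq_integral_abs_deriv_smul measurableSet_Ioo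
    (fun x _ => (hasDerivAt_pow 2 x).hasDerivWithinAt) hinj]
  refine setIntegral_congr_fun measurableSet_Ioo fun x hx => ?_
  have hx0 : (x : ℂ) ≠ 0 := by exact_mod_cast hx.1.ne'
  have e1 : ((x ^ 2 : ℝ) : ℂ) ^ (c / 2 - 1) = (x : ℂ) ^ (c - 2) := by
    rw [pow_two, Complex.ofReal_mul, Complex.mul_cpow_ofReal_nonneg hx.1.le hx.1.le,
      ← Complex.cpow_add _ _ hx0]
    ring_nf
  have e2 : (1 - ((x ^ 2 : ℝ) : ℂ)) ^ (1 - c - 1) =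
      (1 + (x : ℂ)) ^ (-c) * (1 - (x : ℂ)) ^ (1 - c - 1) := by
    have k1 : (1 - ((x ^ 2 : ℝ) : ℂ)) = ((1 + x : ℝ) : ℂ) * ((1 - x : ℝ) : ℂ) := by
      push_cast; ring
    rw [k1, Complex.mul_cpow_ofReal_nonneg (by linarith [hx.1]) (by linarith [hx.2])]
    push_cast
    congr 2
    ring
  have e3 : (x : ℂ) ^ (c - 1) = (x : ℂ) ^ (c - 2) * x := by
    have : c - 1 = c - 2 + 1 := by ring
    rw [this, Complex.cpow_add _ _ hx0, Complex.cpow_one]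
  rw [e1, e2, e3, abs_of_pos (by simpa using hx.1), Complex.real_smul]
  push_cast
  ring

/-- This is the binomial series of `(1+x)^(-c)` added to itself shifted by one index, which loses
the constant term `1`. Integrating against the Beta weight turns each `r_n x^n` into a multiple of
`r_n²`. -/
lemma hasSum_alternating_risingCoeff_sub (c : ℂ) {x : ℝ} (hx : x ∈ Ioo (0 : ℝ) 1) :
    HasSum (fun n : ℕ => (-1) ^ (n + 1) * (risingCoeff c (n + 1) * (x : ℂ) ^ (n + 1) -
      risingCoeff c n * (x : ℂ) ^ n)) (2 * (1 + (x : ℂ)) ^ (-c) - 1) := by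
  have h := hasSum_risingCoeff c (z := -(x : ℂ))
    (by rw [norm_neg, Complex.norm_real, Real.norm_of_nonneg hx.1.le]; exact hx.2)
  rw [sub_neg_eq_add] at h
  have h2 := ((hasSum_nat_add_iff' 1).mpr h).add h
  simp only [Finset.range_one, Finset.sum_singleton, risingCoeff_zero, pow_zero, mul_one] at h2
  convert! h2 using 1
  · ext n
    rw [neg_pow (x : ℂ), neg_pow (x : ℂ) n]
    ring
  · ring

lemma real_Gamma_add_nat_eq_risingCoeff {σ : ℝ} (hσ : 0 < σ) (n : ℕ) :
    Real.Gamma (σ + n) = Real.Gamma σ * ‖risingCoeff (σ : ℂ) n‖ * n.factorial := by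
  apply Complex.ofReal_injective
  have := Gamma_add_nat_eq_risingCoeff (c := (σ : ℂ)) (ne_neg_nat_of_re_pos (by simpa)) n
  rw [Complex.ofReal_mul, Complex.ofReal_mul, norm_risingCoeff_ofReal hσ, ← Complex.Gamma_ofReal,
    ← Complex.Gamma_ofReal]
  push_cast
  exact this

/-- The alternating sum of `risingSqDiff c` is a Beta value. -/
lemma tsum_alternating_risingSqDiff {c : ℂ} (h0 : 0 < c.re) (h1 : c.re < 1) :
    Complex.Gamma c * Complex.Gamma (1 - c) * ∑' n, (-1) ^ n * risingSqDiff c n =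
      Complex.Gamma (c / 2) * Complex.Gamma (1 - c) / Complex.Gamma (c / 2 + (1 - c)) := by
  have h1' : 0 < (1 - c).re := by simpa using h1
  have hcn : ∀ n : ℕ, 0 < (c + n).re := fun n => by simp; positivity
  set w : ℝ → ℂ := fun x => (x : ℂ) ^ (c - 1) * (1 - (x : ℂ)) ^ (1 - c - 1) with hw
  set F : ℕ → ℝ → ℂ := fun n x => (-1) ^ (n + 1) * (risingCoeff c (n + 1) * (x : ℂ) ^ (n + 1) -
      risingCoeff c n * (x : ℂ) ^ n) * w x with hF
  have hwn : ∀ (n : ℕ) (b : ℂ), ∀ x ∈ Ioo (0 : ℝ) 1, (x : ℂ) ^ n *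
      ((x : ℂ) ^ (c - 1) * (1 - (x : ℂ)) ^ (b - 1)) =
      (x : ℂ) ^ (c + n - 1) * (1 - (x : ℂ)) ^ (b - 1) := by
    intro n b x hx
    have hx0 : (x : ℂ) ≠ 0 := by exact_mod_cast hx.1.ne'
    have e : c + n - 1 = c - 1 + n := by ring
    rw [e, Complex.cpow_add _ _ hx0, Complex.cpow_natCast]
    ring
  have hFeq : ∀ n, ∀ x ∈ Ioo (0 : ℝ) 1, F n x = (-1) ^ (n + 1) *
      (risingCoeff c (n + 1) * ((x : ℂ) ^ (c + (n + 1 : ℕ) - 1) * (1 - (x : ℂ)) ^ (1 - c - 1)) -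
        risingCoeff c n * ((x : ℂ) ^ (c + n - 1) * (1 - (x : ℂ)) ^ (1 - c - 1))) := by
    intro n x hx
    rw [← hwn (n + 1) _ x hx, ← hwn n _ x hx]
    simp only [hF, hw]
    ring
  have hbi : ∀ n : ℕ, IntegrableOn (fun x : ℝ =>
      (x : ℂ) ^ (c + n - 1) * (1 - (x : ℂ)) ^ (1 - c - 1)) (Ioo 0 1) := fun n =>
    integrableOn_betaIntegrand (hcn n) h1'
  have hG : ∀ n : ℕ, IntegrableOn (fun x : ℝ => (-1 : ℂ) ^ (n + 1) *
      (risingCoeff c (n + 1) * ((x : ℂ) ^ (c + (n + 1 : ℕ) - 1) * (1 - (x : ℂ)) ^ (1 - c - 1)) -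
        risingCoeff c n * ((x : ℂ) ^ (c + n - 1) * (1 - (x : ℂ)) ^ (1 - c - 1)))) (Ioo 0 1) :=
    fun n => (((hbi (n + 1)).const_mul _).sub ((hbi n).const_mul _)).const_mul _
  have hFint : ∀ n, IntegrableOn (F n) (Ioo 0 1) := fun n =>
    (hG n).congr_fun (fun x hx => (hFeq n x hx).symm) measurableSet_Ioo
  have hFval : ∀ n, ∫ x in Ioo (0 : ℝ) 1, F n x = Complex.Gamma c * Complex.Gamma (1 - c) *
      ((-1) ^ (n + 1) * risingSqDiff c (n + 1)) := by
    intro n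
    rw [setIntegral_congr_fun measurableSet_Ioo (hFeq n), integral_const_mul,
      integral_sub ((hbi (n + 1)).const_mul _) ((hbi n).const_mul _), integral_const_mul,
      integral_const_mul, integral_betaIntegrand_eq_risingCoeff h0 h1,
      integral_betaIntegrand_eq_risingCoeff h0 h1, risingSqDiff]
    ring
  obtain ⟨K, hK, hr⟩ := exists_norm_risingCoeff_succ_le h0 h1
  obtain ⟨K', hK', hr'⟩ := exists_norm_risingCoeff_succ_le (c := (c.re : ℂ)) (by simpa) (by simpa)
  rw [Complex.ofReal_re] at hr'
  -- Consecutive terms are kept paired to gain a factor `1/(n+1)`: the difference splits into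
  -- `(r_{n+1} - r_n) x^(n+1)` and `-r_n x^n (1-x)`, and both have small integrals.
  have hFnorm : ∀ n, ∫ x in Ioo (0 : ℝ) 1, ‖F n x‖ ≤
      K * K' * Real.Gamma c.re * (‖c - 1‖ * Real.Gamma (1 - c.re) + Real.Gamma (2 - c.re)) *
        ((n : ℝ) + 1) ^ (2 * c.re - 3) := by
    intro n
    have hn : (0 : ℝ) < (n : ℝ) + 1 := by positivity
    have h2 : 0 < (2 - c).re := by simp; linarith
    have i1 := (integrableOn_betaIntegrand (hcn (n + 1)) h1').norm.const_mul
      ‖risingCoeff c (n + 1) - risingCoeff c n‖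
    have i2 := (integrableOn_betaIntegrand (hcn n) h2).norm.const_mul ‖risingCoeff c n‖
    have hle := setIntegral_mono_on (hFint n).norm (i1.add i2) measurableSet_Ioo (fun x hx => by
      have e : F n x = (-1) ^ (n + 1) * ((risingCoeff c (n + 1) - risingCoeff c n) *
          ((x : ℂ) ^ (c + (n + 1 : ℕ) - 1) * (1 - (x : ℂ)) ^ (1 - c - 1)) -
          risingCoeff c n * ((x : ℂ) ^ (c + n - 1) * (1 - (x : ℂ)) ^ (2 - c - 1))) := by
        have hx1 : (1 - (x : ℂ)) ≠ 0 := by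
          have : (1 - x : ℝ) ≠ 0 := by linarith [hx.2]
          exact_mod_cast this
        have e2 : (2 - c - 1 : ℂ) = 1 - c - 1 + 1 := by ring
        rw [← hwn (n + 1) _ x hx, ← hwn n _ x hx, e2, Complex.cpow_add _ _ hx1, Complex.cpow_one]
        simp only [hF, hw]
        ring
      rw [e, norm_mul, norm_pow, norm_neg, norm_one, one_pow, one_mul]
      refine (norm_sub_le _ _).trans ?_
      rw [norm_mul (risingCoeff c (n + 1) - risingCoeff c n), norm_mul (risingCoeff c n)]
      rfl)
    refine hle.trans ?_
    simp only [Pi.add_apply]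
    rw [integral_add i1 i2, integral_const_mul, integral_const_mul,
      integral_norm_betaIntegrand (hcn (n + 1)) h1', integral_norm_betaIntegrand (hcn n) h2]
    have r1 : (c + (n + 1 : ℕ)).re = c.re + (n + 1 : ℕ) := by simp
    have r2 : (c + n).re = c.re + n := by simp
    have r3 : (1 - c).re = 1 - c.re := by simp
    have r4 : (2 - c).re = 2 - c.re := by simp
    rw [r1, r2, r3, r4, real_Gamma_add_nat_eq_risingCoeff h0,
      real_Gamma_add_nat_eq_risingCoeff h0, norm_risingCoeff_succ_sub]
    have g1 : Real.Gamma (c.re + (n + 1 : ℕ) + (1 - c.re)) = (n + 1).factorial := by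
      rw [← Real.Gamma_nat_eq_factorial]; congr 1; ring
    have g2 : Real.Gamma (c.re + n + (2 - c.re)) = (n + 1).factorial := by
      rw [← Real.Gamma_nat_eq_factorial]; congr 1; push_cast; ring
    have hf : (((n + 1).factorial : ℕ) : ℝ) = (n + 1) * n.factorial := by
      rw [Nat.factorial_succ]; push_cast; rfl
    have hf0 : (n.factorial : ℝ) ≠ 0 := by exact_mod_cast n.factorial_ne_zero
    have p0 := Real.Gamma_pos_of_pos h0
    have p1 : 0 < Real.Gamma (1 - c.re) := Real.Gamma_pos_of_pos (by linarith)
    have p2 : 0 < Real.Gamma (2 - c.re) := Real.Gamma_pos_of_pos (by linarith)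
    rw [g1, g2, hf, ← rpow_mul_rpow_div hn]
    calc _ = Real.Gamma c.re * ((‖c - 1‖ * Real.Gamma (1 - c.re)) *
          (‖risingCoeff c n‖ * ‖risingCoeff (c.re : ℂ) (n + 1)‖) +
          Real.Gamma (2 - c.re) * (‖risingCoeff c n‖ * ‖risingCoeff (c.re : ℂ) n‖)) /
          ((n : ℝ) + 1) := by field_simp
      _ ≤ Real.Gamma c.re * ((‖c - 1‖ * Real.Gamma (1 - c.re)) *
          ((K * ((n : ℝ) + 1) ^ (c.re - 1)) * (K' * ((n : ℝ) + 1) ^ (c.re - 1))) +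
          Real.Gamma (2 - c.re) *
          ((K * ((n : ℝ) + 1) ^ (c.re - 1)) * (K' * ((n : ℝ) + 1) ^ (c.re - 1)))) /
          ((n : ℝ) + 1) := by
            gcongr
            · exact (hr n).1
            · exact (hr' n).2
            · exact (hr n).1
            · exact (hr' n).1
      _ = _ := by ring
  have hFsum : Summable fun n => ∫ x in Ioo (0 : ℝ) 1, ‖F n x‖ :=
    Summable.of_nonneg_of_le (fun n => integral_nonneg fun x => norm_nonneg _) hFnorm
      ((summable_add_one_rpow (by linarith)).mul_left _)
  have hS := hasSum_integral_of_summable_integral_norm hFint hFsum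
  have hT : ∫ x in Ioo (0 : ℝ) 1, (∑' n, F n x) =
      Complex.Gamma (c / 2) * Complex.Gamma (1 - c) / Complex.Gamma (c / 2 + (1 - c)) -
        Complex.Gamma c * Complex.Gamma (1 - c) := by
    have k0 := integral_betaIntegrand_eq_risingCoeff h0 h1 0
    rw [risingCoeff_zero, mul_one, Nat.cast_zero, add_zero] at k0
    rw [← k0, ← integral_betaIntegrand_mul_add_cpow h0 h1, ← integral_sub]
    · refine setIntegral_congr_fun measurableSet_Ioo fun x hx => ?_
      have := ((hasSum_alternating_risingCoeff_sub c hx).mul_right (w x)).tsum_eq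
      simp only [hF]
      rw [this]
      simp only [hw]
      ring
    · have hb := integrableOn_betaIntegrand h0 h1'
      refine Integrable.bdd_mul (c := 2) hb ?_ ?_
      · refine Measurable.aestronglyMeasurable ?_
        fun_prop
      · rw [ae_restrict_iff' measurableSet_Ioo]
        refine ae_of_all _ fun x hx => ?_
        rw [norm_mul, norm_one_add_cpow hx.1]
        have : (1 + x) ^ (-c).re ≤ 1 :=
          Real.rpow_le_one_of_one_le_of_nonpos (by linarith [hx.1]) (by simpa using h0.le)
        simpa using this
    · exact integrableOn_betaIntegrand h0 h1'
  simp only [hFval] at hS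
  rw [hT] at hS
  obtain ⟨Kβ, -, hβ⟩ := exists_norm_risingSqDiff_le h0 h1
  have hsum : Summable fun n => (-1) ^ n * risingSqDiff c n := by
    refine Summable.of_norm_bounded ((summable_add_one_rpow (e := 2 * c.re - 3)
      (by linarith)).mul_left Kβ) fun n => ?_
    rw [norm_mul, norm_pow, norm_neg, norm_one, one_pow, one_mul]
    exact hβ n
  have h3 := (hsum.hasSum.mul_left (Complex.Gamma c * Complex.Gamma (1 - c)))
  have h4 := ((hasSum_nat_add_iff' 1).mpr h3).unique hS
  have hz : risingSqDiff c 0 = 1 := rfl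
  rw [Finset.range_one, Finset.sum_singleton, pow_zero, hz, mul_one, mul_one] at h4
  linear_combination h4

/-- The closed form is a quotient of Gamma values at points of positive real part. This nonvanishing
is what makes the bound in (a) sharp. -/
lemma tsum_alternating_risingSqDiff_ne_zero {c : ℂ} (h0 : 0 < c.re) (h1 : c.re < 1) :
    ∑' n, (-1) ^ n * risingSqDiff c n ≠ 0 := by
  intro h
  have h2 := tsum_alternating_risingSqDiff h0 h1
  rw [h, mul_zero] at h2
  have e1 : (c / 2).re = c.re / 2 := by simp
  have g1 : Complex.Gamma (c / 2) ≠ 0 :=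
    Complex.Gamma_ne_zero_of_re_pos (by rw [e1]; positivity)
  have g2 : Complex.Gamma (1 - c) ≠ 0 := Complex.Gamma_ne_zero_of_re_pos (by simpa using h1)
  have g3 : Complex.Gamma (c / 2 + (1 - c)) ≠ 0 :=
    Complex.Gamma_ne_zero_of_re_pos (by
      rw [Complex.add_re, e1, Complex.sub_re, Complex.one_re]; linarith)
  exact div_ne_zero (mul_ne_zero g1 g2) g3 h2.symm

/-! ### Summation by parts. -/

lemma sum_mul_sub_succ (α : ℕ → ℂ) (C : ℕ → ℂ) (N : ℕ) :
    ∑ n ∈ Finset.range (N + 1), α n * (C n - C (n + 1)) =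
      α 0 * C 0 + ∑ n ∈ Finset.range N, (α (n + 1) - α n) * C (n + 1) - α N * C (N + 1) := by
  induction N with
  | zero => simp; ring
  | succ N ih => rw [Finset.sum_range_succ, ih, Finset.sum_range_succ]; ring

lemma sum_risingCoeff_sq_mul_sub (c : ℂ) (C : ℕ → ℂ) (N : ℕ) :
    ∑ n ∈ Finset.range (N + 1), risingCoeff c n ^ 2 * (C n - C (n + 1)) =
      ∑ n ∈ Finset.range (N + 1), risingSqDiff c n * C n - risingCoeff c N ^ 2 * C (N + 1) := by
  rw [sum_mul_sub_succ (fun n => risingCoeff c n ^ 2), Finset.sum_range_succ', risingCoeff_zero]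
  simp only [risingSqDiff]
  ring

/-- In Beta notation, `B(a+n, b) - B(a+n+1, b) = B(a+n, b+1)`. -/
lemma Gamma_div_sub_succ {a b : ℂ} (hb : b ≠ 0) {n : ℕ} (ha : a + n ≠ 0) (hab : a + b + n ≠ 0)
    (hG : Complex.Gamma (a + b + n) ≠ 0) :
    Complex.Gamma (a + n) * Complex.Gamma b / Complex.Gamma (a + b + n) -
      Complex.Gamma (a + (n + 1 : ℕ)) * Complex.Gamma b / Complex.Gamma (a + b + (n + 1 : ℕ)) =
    Complex.Gamma (a + n) * Complex.Gamma (b + 1) / Complex.Gamma (a + n + (b + 1)) := by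
  have e1 : a + ((n + 1 : ℕ) : ℂ) = a + n + 1 := by push_cast; ring
  have e2 : a + b + ((n + 1 : ℕ) : ℂ) = a + b + n + 1 := by push_cast; ring
  have e3 : a + n + (b + 1) = a + b + n + 1 := by ring
  rw [e1, e2, e3, Complex.Gamma_add_one _ ha, Complex.Gamma_add_one _ hab,
    Complex.Gamma_add_one _ hb]
  field_simp
  ring

/-- Summation by parts for `∑ (c)_n² / n!² * B(a + n, b + 1)`. -/
lemma hasSum_risingSqDiff_of_hasSum {c a b S : ℂ} {M : ℝ} (h0 : 0 < c.re) (h1 : c.re < 1)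
    (hb : b ≠ 0) (ha : ∀ m : ℕ, a ≠ -m) (hab : ∀ m : ℕ, a + b ≠ -m)
    (hM : ∀ n : ℕ, ‖Complex.Gamma (a + n) * Complex.Gamma b / Complex.Gamma (a + b + n)‖ ≤
      M * ((n : ℝ) + 1) ^ (1 - c.re))
    (hS : HasSum (fun n : ℕ => risingCoeff c n ^ 2 *
      (Complex.Gamma (a + n) * Complex.Gamma (b + 1) / Complex.Gamma (a + n + (b + 1)))) S) :
    HasSum (fun n : ℕ => risingSqDiff c n *
      (Complex.Gamma (a + n) * Complex.Gamma b / Complex.Gamma (a + b + n))) S := by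
  set C : ℕ → ℂ := fun n => Complex.Gamma (a + n) * Complex.Gamma b / Complex.Gamma (a + b + n)
    with hC
  have hne : ∀ {z : ℂ}, (∀ m : ℕ, z ≠ -m) → ∀ n : ℕ, z + n ≠ 0 := fun hz n h =>
    hz n (eq_neg_of_add_eq_zero_left h)
  have hG : ∀ n : ℕ, Complex.Gamma (a + b + n) ≠ 0 := fun n => Complex.Gamma_ne_zero fun m h =>
    hab (m + n) (by push_cast; linear_combination h)
  have hdiff : ∀ n : ℕ, Complex.Gamma (a + n) * Complex.Gamma (b + 1) /
      Complex.Gamma (a + n + (b + 1)) = C n - C (n + 1) := fun n =>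
    (Gamma_div_sub_succ hb (hne ha n) (hne hab n) (hG n)).symm
  simp only [hdiff] at hS
  obtain ⟨K, hK, hβ⟩ := exists_norm_risingSqDiff_le h0 h1
  obtain ⟨K', hK', hr⟩ := exists_norm_risingCoeff_le h0
  have hsum : Summable fun n => risingSqDiff c n * C n := by
    refine Summable.of_norm_bounded ((summable_add_one_rpow (e := c.re - 2)
      (by linarith)).mul_left (K * M)) fun n => ?_
    have hn : (0 : ℝ) < (n : ℝ) + 1 := by positivity
    rw [norm_mul]
    calc _ ≤ (K * ((n : ℝ) + 1) ^ (2 * c.re - 3)) * (M * ((n : ℝ) + 1) ^ (1 - c.re)) :=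
          mul_le_mul (hβ n) (hM n) (norm_nonneg _) (by positivity)
      _ = K * M * (((n : ℝ) + 1) ^ (2 * c.re - 3) * ((n : ℝ) + 1) ^ (1 - c.re)) := by ring
      _ = _ := by rw [← Real.rpow_add hn]; ring_nf
  have hM0 : 0 ≤ M := by
    have := (norm_nonneg _).trans (hM 0)
    simpa using this
  -- The boundary term is `O(N^(2σ-2) · N^(1-σ)) = O(N^(σ-1))` with `σ = Re c < 1`.
  have hbdry : Tendsto (fun N => risingCoeff c N ^ 2 * C (N + 1)) atTop (𝓝 0) := by
    have hlim : Tendsto (fun N : ℕ => K' ^ 2 * M * 2 ^ (1 - c.re) * ((N : ℝ) + 1) ^ (c.re - 1))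
        atTop (𝓝 0) := by
      have h := (tendsto_rpow_neg_atTop (y := 1 - c.re) (by linarith)).comp
        (tendsto_atTop_add_const_right atTop (1 : ℝ) tendsto_natCast_atTop_atTop)
      have := h.const_mul (K' ^ 2 * M * 2 ^ (1 - c.re))
      rw [mul_zero] at this
      refine this.congr fun N => ?_
      simp only [Function.comp, neg_sub]
    refine squeeze_zero_norm (fun N => ?_) hlim
    have hN : (0 : ℝ) < (N : ℝ) + 1 := by positivity
    rw [norm_mul, norm_pow]
    have k1 : (((N + 1 : ℕ) : ℝ) + 1) ^ (1 - c.re) ≤ 2 ^ (1 - c.re) * ((N : ℝ) + 1) ^ (1 - c.re) := by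
      rw [← Real.mul_rpow (by norm_num) hN.le]
      refine Real.rpow_le_rpow (by positivity) ?_ (by linarith)
      push_cast
      linarith [(N.cast_nonneg : (0 : ℝ) ≤ N)]
    calc _ ≤ (K' * ((N : ℝ) + 1) ^ (c.re - 1)) ^ 2 *
          (M * (2 ^ (1 - c.re) * ((N : ℝ) + 1) ^ (1 - c.re))) := by
          refine mul_le_mul (pow_le_pow_left₀ (norm_nonneg _) (hr N) 2)
            ((hM (N + 1)).trans (mul_le_mul_of_nonneg_left k1 hM0)) (norm_nonneg _) (by positivity)
      _ = K' ^ 2 * M * 2 ^ (1 - c.re) * (((N : ℝ) + 1) ^ (c.re - 1) *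
          ((N : ℝ) + 1) ^ (c.re - 1) * ((N : ℝ) + 1) ^ (1 - c.re)) := by ring
      _ = _ := by rw [← Real.rpow_add hN, ← Real.rpow_add hN]; ring_nf
  have t1 := (tendsto_add_atTop_iff_nat 1).mpr hS.tendsto_sum_nat
  have t2 := ((tendsto_add_atTop_iff_nat 1).mpr hsum.hasSum.tendsto_sum_nat).sub hbdry
  simp only [sum_risingCoeff_sq_mul_sub] at t1
  have := tendsto_nhds_unique t1 t2
  rw [this, sub_zero]
  exact hsum.hasSum

/-! ### Limits of Pochhammer quotients and of the Gamma prefactor. -/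

lemma tendsto_sub_div_add_I_mul (u v : ℂ) :
    Tendsto (fun t : ℝ => (u - Complex.I * t) / (v + Complex.I * t))
      (comap (fun t : ℝ => |t|) atTop) (𝓝 (-1)) := by
  have hb : Tendsto (fun t : ℝ => v + Complex.I * t) (comap (fun t : ℝ => |t|) atTop)
      (Bornology.cobounded ℂ) := by
    rw [← tendsto_norm_atTop_iff_cobounded]
    refine tendsto_atTop_mono (f := fun t : ℝ => |t| - ‖v‖) (fun t => ?_)
      (tendsto_atTop_add_const_right _ _ tendsto_comap)
    have := norm_sub_le (v + Complex.I * t) v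
    simp at this
    linarith
  have h := ((tendsto_inv₀_cobounded.comp hb).const_mul (u + v)).add_const (-1)
  rw [mul_zero, zero_add] at h
  refine h.congr' ?_
  filter_upwards [hb.eventually_ne_cobounded 0] with t ht
  simp only [Function.comp]
  field_simp
  ring

lemma im_ne_zero_of_abs {z : ℂ} {t : ℝ} (h : ‖z‖ < |t|) : (z + Complex.I * t).im ≠ 0 := by
  intro h2
  have h3 : z.im = -t := by simp at h2; linarith
  have := Complex.abs_im_le_norm z
  rw [h3, abs_neg] at this
  linarith

lemma norm_natCast_add_I_mul_le {t : ℝ} (ht : 1 ≤ |t|) (n : ℕ) :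
    ‖(n : ℂ) + Complex.I * t‖ ≤ ((n : ℝ) + 1) * |t| := by
  have h := norm_add_le (n : ℂ) (Complex.I * t)
  simp at h
  have : (0 : ℝ) ≤ n := n.cast_nonneg
  nlinarith

/-- By conjugation, for real `κ`. It brings Gamma values at `-it` and `it` to shifts of one common
point, as the quotient bounds require. -/
lemma norm_Gamma_sub_I_mul {κ : ℝ} (t : ℝ) :
    ‖Complex.Gamma (κ - Complex.I * t)‖ = ‖Complex.Gamma (κ + Complex.I * t)‖ := by
  rw [← Complex.norm_conj, ← Complex.Gamma_conj]
  congr 2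
  simp

/-- The quotient `(a - it)_n / (v + it)_n`. -/
noncomputable def risingQuot (a : ℝ) (v : ℂ) (n : ℕ) (t : ℝ) : ℂ :=
  Complex.Gamma (a - Complex.I * t + n) / Complex.Gamma (v + Complex.I * t + n) *
    (Complex.Gamma (v + Complex.I * t) / Complex.Gamma (a - Complex.I * t))

lemma tendsto_risingQuot (a : ℝ) (v : ℂ) (n : ℕ) :
    Tendsto (risingQuot a v n) (comap (fun t : ℝ => |t|) atTop) (𝓝 ((-1) ^ n)) := by
  have h : Tendsto (fun t : ℝ => ∏ k ∈ Finset.range n,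
      (((a : ℂ) + k - Complex.I * t) / (v + k + Complex.I * t)))
      (comap (fun t : ℝ => |t|) atTop) (𝓝 (∏ _k ∈ Finset.range n, (-1))) :=
    tendsto_finsetProd _ fun k _ => tendsto_sub_div_add_I_mul _ _
  rw [Finset.prod_const, Finset.card_range] at h
  refine h.congr' ?_
  filter_upwards [tendsto_comap.eventually (eventually_gt_atTop ‖v‖),
    tendsto_comap.eventually (eventually_gt_atTop 0)] with t ht ht0
  have h1 : ∀ m : ℕ, (a : ℂ) - Complex.I * t ≠ -m :=
    ne_neg_nat_of_im_ne_zero (by simpa using ht0)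
  have h2 : ∀ m : ℕ, v + Complex.I * t ≠ -m := ne_neg_nat_of_im_ne_zero (im_ne_zero_of_abs ht)
  have g1 := Complex.Gamma_ne_zero h1
  have g2 := Complex.Gamma_ne_zero h2
  rw [risingQuot, Gamma_add_nat_eq h1, Gamma_add_nat_eq h2, Finset.prod_div_distrib]
  have e1 : ∀ k : ℕ, (a : ℂ) + k - Complex.I * t = a - Complex.I * t + k := fun k => by ring
  have e2 : ∀ k : ℕ, v + k + Complex.I * t = v + Complex.I * t + k := fun k => by ring
  simp only [e1, e2]
  rw [mul_div_mul_comm, mul_comm (_ / _), mul_assoc, div_mul_div_cancel₀ g2, div_self g1, mul_one]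

/-- The quotient at `n` is bounded by a power of `|n + it| ≤ (n+1)|t|`, and the normalizing quotient
by the opposite power of `|t|`. The powers of `|t|` cancel, so the bound is uniform in `t`. -/
lemma exists_norm_risingQuot_le (a : ℝ) {v : ℂ} (hav : 0 ≤ a - v.re) :
    ∃ T K : ℝ, 1 ≤ T ∧ 0 < K ∧ ∀ t : ℝ, T ≤ |t| → ∀ n : ℕ,
      ‖risingQuot a v n t‖ ≤ K * ((n : ℝ) + 1) ^ (a - v.re) := by
  obtain ⟨T₁, K₁, hT₁, hK₁, h1⟩ := norm_Gamma_div_Gamma_le a v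
  obtain ⟨T₂, K₂, hT₂, hK₂, h2⟩ := norm_Gamma_div_Gamma_le v a
  refine ⟨max T₁ T₂, K₁ * K₂, hT₁.trans (le_max_left _ _), by positivity, fun t ht n => ?_⟩
  have ht1 : 1 ≤ |t| := (hT₁.trans (le_max_left _ _)).trans ht
  have ht0 : 0 < |t| := by linarith
  have k1 := h1 (n + Complex.I * t) (by simp) (by simpa using (le_max_left _ _).trans ht)
  have k2 := h2 (Complex.I * t) (by simp) (by simpa using (le_max_right _ _).trans ht)
  have e1 : ‖Complex.Gamma (a - Complex.I * t + n)‖ =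
      ‖Complex.Gamma (n + Complex.I * t + a)‖ := by
    have := norm_Gamma_sub_I_mul (κ := a + n) t
    push_cast at this
    rw [show (a : ℂ) - Complex.I * t + n = a + n - Complex.I * t by ring, this]
    congr 2; ring
  have e2 : ‖Complex.Gamma (a - Complex.I * t)‖ = ‖Complex.Gamma (Complex.I * t + a)‖ := by
    rw [norm_Gamma_sub_I_mul, add_comm]
  have e3 : v + Complex.I * t + n = n + Complex.I * t + v := by ring
  have e4 : ‖Complex.I * (t : ℂ)‖ = |t| := by simp
  have r1 : ((a : ℂ) - v).re = a - v.re := by simp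
  have r2 : (v - (a : ℂ)).re = -(a - v.re) := by simp
  rw [norm_div, r1] at k1
  rw [norm_div, r2, e4] at k2
  rw [risingQuot, norm_mul, norm_div, norm_div, e1, e2, e3, add_comm v]
  calc _ ≤ (K₁ * (((n : ℝ) + 1) * |t|) ^ (a - v.re)) * (K₂ * |t| ^ (-(a - v.re))) := by
        refine mul_le_mul (k1.trans ?_) k2 (by positivity) (by positivity)
        gcongr
        exact norm_natCast_add_I_mul_le ht1 n
    _ = K₁ * K₂ * ((n : ℝ) + 1) ^ (a - v.re) * (|t| ^ (a - v.re) * |t| ^ (-(a - v.re))) := by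
        rw [Real.mul_rpow (by positivity) ht0.le]; ring
    _ = _ := by rw [← Real.rpow_add ht0, add_neg_cancel, Real.rpow_zero, mul_one]

/-- Duplication splits `Γ(c-1+2it)` into Gamma values at `it + (c-1)/2` and `it + c/2`. Pairing them
with the two denominators leaves the total exponent `-1/2`. -/
lemma tendsto_sqrt_mul_norm_Gamma_div (c : ℂ) (κ : ℝ) :
    Tendsto (fun t : ℝ => √|t| * ‖Complex.Gamma (c - 1 + 2 * (Complex.I * t)) /
      (Complex.Gamma ((1 / 2 + κ : ℝ) - Complex.I * t) *
        Complex.Gamma (c - 1 / 2 - κ + Complex.I * t))‖)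
      (comap (fun t : ℝ => |t|) atTop) (𝓝 (2 ^ (2 - c.re) * √Real.pi)⁻¹) := by
  have h := ((tendsto_Gamma_div_Gamma ((c - 1) / 2) ((1 / 2 + κ : ℝ) : ℂ)).mul
    (tendsto_Gamma_div_Gamma (c / 2) (c - 1 / 2 - κ))).norm.mul_const
    (2 ^ (2 - c.re) * √Real.pi)⁻¹
  rw [mul_one, norm_one, one_mul] at h
  refine h.congr' ?_
  filter_upwards [tendsto_comap.eventually (eventually_gt_atTop 0)] with t ht
  have hdup := Complex.Gamma_mul_Gamma_add_half (Complex.I * t + (c - 1) / 2)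
  have e1 : Complex.I * t + (c - 1) / 2 + 1 / 2 = Complex.I * t + c / 2 := by ring
  have e2 : 2 * (Complex.I * t + (c - 1) / 2) = c - 1 + 2 * (Complex.I * t) := by ring
  rw [e1, e2] at hdup
  have hn := congrArg norm hdup
  have hp : ‖(2 : ℂ) ^ (1 - (c - 1 + 2 * (Complex.I * t)))‖ = 2 ^ (2 - c.re) := by
    have := Complex.norm_cpow_eq_rpow_re_of_pos (x := 2) two_pos
      (1 - (c - 1 + 2 * (Complex.I * t)))
    push_cast at this
    rw [this]
    congr 1
    simp
    ring
  rw [norm_mul, norm_mul, norm_mul, hp, Complex.norm_real,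
    Real.norm_of_nonneg (Real.sqrt_nonneg _)] at hn
  have hexp : Complex.exp ((((1 / 2 + κ : ℝ) : ℂ) - (c - 1) / 2) * Complex.log (Complex.I * t)) *
      Complex.exp ((c - 1 / 2 - κ - c / 2) * Complex.log (Complex.I * t)) =
      Complex.exp (((1 / 2 : ℝ) : ℂ) * Complex.log (Complex.I * t)) := by
    rw [← Complex.exp_add]
    congr 1
    push_cast
    ring
  have hsq : ‖Complex.exp (((1 / 2 : ℝ) : ℂ) * Complex.log (Complex.I * t))‖ = √|t| := by
    rw [Complex.norm_exp, Complex.re_ofReal_mul, Complex.log_re, Real.sqrt_eq_rpow,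
      Real.rpow_def_of_pos ht, mul_comm]
    simp
  have hd := norm_Gamma_sub_I_mul (κ := 1 / 2 + κ) t
  rw [mul_mul_mul_comm, hexp, norm_mul, hsq]
  simp only [norm_mul, norm_div]
  rw [hd, add_comm ((1 / 2 + κ : ℝ) : ℂ), add_comm (c - 1 / 2 - κ), div_mul_div_comm, hn]
  have hpos : 2 ^ (2 - c.re) * √Real.pi ≠ 0 := by positivity
  field_simp

/-! ### Part (a): the product of two Whittaker functions. -/

lemma whittakerW_eq_eulerLaplace (κ μ : ℂ) (y : ℝ) :
    whittakerW κ μ y = Complex.exp (-(y : ℂ) / 2) * (y : ℂ) ^ (μ + 1 / 2) /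
      Complex.Gamma (1 / 2 + μ - κ) * eulerLaplace (1 / 2 + μ - κ) (1 / 2 + μ + κ) y := by
  rw [whittakerW, eulerLaplace]
  congr 2
  ext x
  have e1 : 1 / 2 + μ - κ - 1 = μ - κ - 1 / 2 := by ring
  have e2 : 1 / 2 + μ + κ - 1 = μ + κ - 1 / 2 := by ring
  rw [eulerKernel, e1, e2, mul_assoc]

lemma exp_neg_half_mul_self (y : ℝ) :
    Complex.exp (-(y : ℂ) / 2) * Complex.exp (-(y : ℂ) / 2) = Complex.exp (-(y : ℂ)) := by
  rw [← Complex.exp_add]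
  ring_nf

lemma whittakerProductIntegrand_eq (p : ℤ) {s₀ s w : ℂ} (hsw : s + w = 1) {y : ℝ} (hy : 0 < y) :
    whittakerProductIntegrand p s₀ s w y =
      1 / (Complex.Gamma s₀ * Complex.Gamma (w - (p : ℂ) / 4)) *
        ((y : ℂ) ^ (s₀ - 1) * Complex.exp (-(y : ℂ)) *
          (eulerLaplace s₀ s₀ y * eulerLaplace (w - (p : ℂ) / 4) (w + (p : ℂ) / 4) y)) := by
  have hy0 : (y : ℂ) ≠ 0 := by exact_mod_cast hy.ne'
  have e1 : 1 / 2 + (s₀ - 1 / 2) - 0 = s₀ := by ring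
  have e2 : 1 / 2 + (s₀ - 1 / 2) + 0 = s₀ := by ring
  have e3 : s₀ - 1 / 2 + 1 / 2 = s₀ := by ring
  have e4 : 1 / 2 + (w - 1 / 2) - (p : ℂ) / 4 = w - (p : ℂ) / 4 := by ring
  have e5 : 1 / 2 + (w - 1 / 2) + (p : ℂ) / 4 = w + (p : ℂ) / 4 := by ring
  have e6 : w - 1 / 2 + 1 / 2 = w := by ring
  have hpow : (y : ℂ) ^ s₀ * (y : ℂ) ^ w * (y : ℂ) ^ (s - 1) / y = (y : ℂ) ^ (s₀ - 1) := by
    have e : s₀ - 1 = s₀ + w + (s - 1) - 1 := by linear_combination -hsw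
    rw [← Complex.cpow_add _ _ hy0, ← Complex.cpow_add _ _ hy0, e, Complex.cpow_sub _ _ hy0,
      Complex.cpow_one]
  rw [whittakerProductIntegrand, whittakerW_eq_eulerLaplace, whittakerW_eq_eulerLaplace, e1, e2, e3,
    e4, e5, e6, ← hpow, ← exp_neg_half_mul_self]
  ring

lemma re_sub_intCast_div (w : ℂ) (p : ℤ) : (w - (p : ℂ) / 4).re = w.re - p / 4 := by
  simp

lemma re_add_intCast_div (w : ℂ) (p : ℤ) : (w + (p : ℂ) / 4).re = w.re + p / 4 := by
  simp

lemma abs_intCast_le_one {p : ℤ} (hp : p = 1 ∨ p = -1) : |(p : ℝ)| ≤ 1 := by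
  rcases hp with rfl | rfl <;> simp

section Product

variable {p : ℤ} {s₀ s w : ℂ}

lemma integrableOn_whittakerProductIntegrand (hp : |(p : ℝ)| ≤ 1) (h0 : 0 < s₀.re)
    (h1 : s₀.re < 1) (hsw : s + w = 1) (hw : w.re = 1 / 2) :
    IntegrableOn (whittakerProductIntegrand p s₀ s w) (Ioi 0) := by
  obtain ⟨hp1, hp2⟩ := abs_le.mp hp
  -- With `σ = Re s₀`, the choice `θ = 1 - σ` reduces the two decay conditions to `(1-σ)² > 0` and
  -- `σ(1-σ) > 0`, so the whole strip is covered.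
  have h := integrableOn_eulerLaplace_mul (c := s₀) (a₁ := s₀) (d₁ := s₀)
    (a₂ := w - (p : ℂ) / 4) (d₂ := w + (p : ℂ) / 4) (θ := 1 - s₀.re) h0 h0
    (by rw [re_sub_intCast_div]; linarith) (by linarith) (by linarith)
    (by nlinarith [sq_pos_of_pos (sub_pos.mpr h1)])
    (by rw [re_sub_intCast_div, re_add_intCast_div, hw]; nlinarith)
  exact IntegrableOn.congr_fun (h.const_mul _)
    (fun y hy => (whittakerProductIntegrand_eq p hsw hy).symm) measurableSet_Ioi

/-- With `c = a₁ = d₁ = s₀` the first Beta factor is `Γ(s₀+n) Γ(1-s₀)/n!`, which supplies the second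
power of `risingCoeff s₀ n`. -/
lemma hasSum_normalizedProductMellin (hp : |(p : ℝ)| ≤ 1) (h0 : 0 < s₀.re)
    (h1 : s₀.re < 1) (hsw : s + w = 1) (hw : w.re = 1 / 2) :
    HasSum (fun n : ℕ => risingCoeff s₀ n ^ 2 * (Complex.Gamma (w - (p : ℂ) / 4 + n) *
      Complex.Gamma (s₀ - 2 * w + 1) / Complex.Gamma (w - (p : ℂ) / 4 + n + (s₀ - 2 * w + 1))))
      (Complex.Gamma (w + (p : ℂ) / 4) * Complex.Gamma (w - (p : ℂ) / 4) /
        (Complex.Gamma s₀ * Complex.Gamma (1 - s₀)) * normalizedProductMellin p s₀ s w) := by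
  obtain ⟨hp1, hp2⟩ := abs_le.mp hp
  have h := hasSum_integral_eulerLaplace_mul (c := s₀) (a₁ := s₀) (d₁ := s₀)
    (a₂ := w - (p : ℂ) / 4) (d₂ := w + (p : ℂ) / 4) (θ := 1 - s₀.re) h0 h0
    (by rw [re_sub_intCast_div]; linarith) (by linarith) (by linarith)
    (by nlinarith [sq_pos_of_pos (sub_pos.mpr h1)])
    (by rw [re_sub_intCast_div, re_add_intCast_div, hw]; nlinarith)
  have g0 := Complex.Gamma_ne_zero_of_re_pos h0
  have g1 : Complex.Gamma (1 - s₀) ≠ 0 := Complex.Gamma_ne_zero_of_re_pos (by simpa using h1)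
  have g2 : Complex.Gamma (w - (p : ℂ) / 4) ≠ 0 :=
    Complex.Gamma_ne_zero_of_re_pos (by rw [re_sub_intCast_div]; linarith)
  have g3 : Complex.Gamma (w + (p : ℂ) / 4) ≠ 0 :=
    Complex.Gamma_ne_zero_of_re_pos (by rw [re_add_intCast_div]; linarith)
  have hI : normalizedProductMellin p s₀ s w = 1 / Complex.Gamma (w + (p : ℂ) / 4) *
      (1 / (Complex.Gamma s₀ * Complex.Gamma (w - (p : ℂ) / 4)) *
        ∫ y in Ioi (0 : ℝ), (y : ℂ) ^ (s₀ - 1) * Complex.exp (-(y : ℂ)) *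
          (eulerLaplace s₀ s₀ y * eulerLaplace (w - (p : ℂ) / 4) (w + (p : ℂ) / 4) y)) := by
    have hI0 := setIntegral_congr_fun (μ := volume) (measurableSet_Ioi (a := (0 : ℝ)))
      fun y hy => whittakerProductIntegrand_eq p (s₀ := s₀) hsw (mem_Ioi.mp hy)
    rw [normalizedProductMellin, hI0, integral_const_mul]
  have h2 := h.mul_left (1 / (Complex.Gamma s₀ ^ 2 * Complex.Gamma (1 - s₀)))
  convert! h2 using 1
  · ext n
    have e1 : s₀ + 1 - s₀ - s₀ = 1 - s₀ := by ring
    have e2 : s₀ + n + (1 - s₀) = n + 1 := by ring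
    have e3 : s₀ + 1 - (w - (p : ℂ) / 4) - (w + (p : ℂ) / 4) = s₀ - 2 * w + 1 := by ring
    have hf : (n.factorial : ℂ) ≠ 0 := by exact_mod_cast n.factorial_ne_zero
    rw [e1, e2, e3, Complex.Gamma_nat_eq_factorial,
      Gamma_add_nat_eq_risingCoeff (ne_neg_nat_of_re_pos h0)]
    field_simp
  · rw [hI]
    generalize Complex.Gamma (w + (p : ℂ) / 4) = A at g3 ⊢
    generalize Complex.Gamma (w - (p : ℂ) / 4) = B at g2 ⊢
    field_simp

/-- Rearranged series for the normalized Mellin integral on the critical line. -/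
lemma normalizedProductMellin_eq_tsum (hp : |(p : ℝ)| ≤ 1) (h0 : 0 < s₀.re) (h1 : s₀.re < 1)
    {t M : ℝ} (ht : ‖s₀ - 1‖ < |t|) (ht' : ‖s₀ - 1 / 2 - (p : ℂ) / 4‖ < |t|)
    (hM : ∀ n : ℕ, ‖risingQuot (1 / 2 - p / 4) (s₀ - 1 / 2 - (p : ℂ) / 4) n t‖ ≤
      M * ((n : ℝ) + 1) ^ (1 - s₀.re)) :
    normalizedProductMellin p s₀ (1 / 2 + Complex.I * t) (1 - (1 / 2 + Complex.I * t)) =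
      Complex.Gamma s₀ * Complex.Gamma (1 - s₀) *
        (Complex.Gamma (s₀ - 1 + 2 * (Complex.I * t)) /
          (Complex.Gamma ((1 / 2 + p / 4 : ℝ) - Complex.I * t) *
            Complex.Gamma (s₀ - 1 / 2 - (p / 4 : ℝ) + Complex.I * t))) *
        ∑' n, risingSqDiff s₀ n * risingQuot (1 / 2 - p / 4) (s₀ - 1 / 2 - (p : ℂ) / 4) n t := by
  obtain ⟨hp1, hp2⟩ := abs_le.mp hp
  set w : ℂ := 1 - (1 / 2 + Complex.I * t) with hw
  have hwre : w.re = 1 / 2 := by simp [hw]; norm_num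
  have h := hasSum_normalizedProductMellin (s := 1 / 2 + Complex.I * t) (w := w) hp h0 h1
    (by rw [hw]; ring) hwre
  have ht0 : 0 < |t| := (norm_nonneg _).trans_lt ht
  set a : ℂ := w - (p : ℂ) / 4 with ha
  set b : ℂ := s₀ - 2 * w with hb
  have ea : a = ((1 / 2 - p / 4 : ℝ) : ℂ) - Complex.I * t := by rw [ha, hw]; push_cast; ring
  have eb : b = s₀ - 1 + 2 * (Complex.I * t) := by rw [hb, hw]; ring
  have eab : a + b = s₀ - 1 / 2 - (p : ℂ) / 4 + Complex.I * t := by rw [ha, hb, hw]; ring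
  have ed : w + (p : ℂ) / 4 = ((1 / 2 + p / 4 : ℝ) : ℂ) - Complex.I * t := by
    rw [hw]; push_cast; ring
  have him : b.im ≠ 0 := by
    have := im_ne_zero_of_abs (z := s₀ - 1) (t := 2 * t) (by
      rw [abs_mul, abs_two]; linarith)
    rw [eb]
    convert this using 3
    push_cast
    ring
  have hb0 : b ≠ 0 := fun h => him (by rw [h]; simp)
  have haim : a.im ≠ 0 := by rw [ea]; simpa using ht0
  have habim : (a + b).im ≠ 0 := by rw [eab]; exact im_ne_zero_of_abs ht'
  have ga := Complex.Gamma_ne_zero (ne_neg_nat_of_im_ne_zero haim)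
  have gb := Complex.Gamma_ne_zero (ne_neg_nat_of_im_ne_zero him)
  have gab := Complex.Gamma_ne_zero (ne_neg_nat_of_im_ne_zero habim)
  have gd : Complex.Gamma (w + (p : ℂ) / 4) ≠ 0 :=
    Complex.Gamma_ne_zero_of_re_pos (by rw [re_add_intCast_div]; linarith)
  have g0 := Complex.Gamma_ne_zero_of_re_pos h0
  have g1 : Complex.Gamma (1 - s₀) ≠ 0 := Complex.Gamma_ne_zero_of_re_pos (by simpa using h1)
  have hE : ∀ n : ℕ, Complex.Gamma (a + n) * Complex.Gamma b / Complex.Gamma (a + b + n) =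
      Complex.Gamma a * Complex.Gamma b / Complex.Gamma (a + b) *
        risingQuot (1 / 2 - p / 4) (s₀ - 1 / 2 - (p : ℂ) / 4) n t := by
    intro n
    rw [risingQuot, ← ea, ← eab]
    field_simp
  have hS := hasSum_risingSqDiff_of_hasSum h0 h1 hb0 (ne_neg_nat_of_im_ne_zero haim)
    (ne_neg_nat_of_im_ne_zero habim)
    (M := ‖Complex.Gamma a * Complex.Gamma b / Complex.Gamma (a + b)‖ * M) (fun n => by
      rw [hE, norm_mul, mul_assoc]
      exact mul_le_mul_of_nonneg_left (hM n) (norm_nonneg _)) h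
  simp only [hE] at hS
  have hS2 := hS.tsum_eq
  have e5 : ∀ n, risingSqDiff s₀ n * (Complex.Gamma a * Complex.Gamma b / Complex.Gamma (a + b) *
        risingQuot (1 / 2 - p / 4) (s₀ - 1 / 2 - (p : ℂ) / 4) n t) =
      Complex.Gamma a * Complex.Gamma b / Complex.Gamma (a + b) *
        (risingSqDiff s₀ n * risingQuot (1 / 2 - p / 4) (s₀ - 1 / 2 - (p : ℂ) / 4) n t) := by
    intro n; ring
  simp only [e5] at hS2
  rw [tsum_mul_left] at hS2
  have e6 : s₀ - 1 / 2 - ((p / 4 : ℝ) : ℂ) + Complex.I * t = a + b := by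
    rw [eab]; push_cast; ring
  rw [← eb, ← ed, e6]
  generalize ∑' n, risingSqDiff s₀ n *
    risingQuot (1 / 2 - p / 4) (s₀ - 1 / 2 - (p : ℂ) / 4) n t = S at hS2 ⊢
  generalize normalizedProductMellin p s₀ (1 / 2 + Complex.I * t) w = N at hS2 ⊢
  generalize Complex.Gamma (w + (p : ℂ) / 4) = D at hS2 gd ⊢
  field_simp at hS2 ⊢
  linear_combination -hS2

end Product

/-- Dominated convergence for series: the bounds `n^(2σ-3)` and `n^(1-σ)`, `σ = Re c`, multiply to
the summable `n^(σ-2)`. -/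
lemma tendsto_tsum_risingSqDiff_mul_risingQuot {c : ℂ} (h0 : 0 < c.re) (h1 : c.re < 1) {a : ℝ}
    {v : ℂ} (hav : a - v.re = 1 - c.re) :
    Tendsto (fun t : ℝ => ∑' n, risingSqDiff c n * risingQuot a v n t)
      (comap (fun t : ℝ => |t|) atTop) (𝓝 (∑' n, (-1) ^ n * risingSqDiff c n)) := by
  obtain ⟨K, hK, hβ⟩ := exists_norm_risingSqDiff_le h0 h1
  obtain ⟨T, K', hT, hK', hq⟩ := exists_norm_risingQuot_le a (v := v) (by rw [hav]; linarith)
  refine tendsto_tsum_of_dominated_convergence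
    (bound := fun n : ℕ => K * K' * ((n : ℝ) + 1) ^ (c.re - 2))
    ((summable_add_one_rpow (by linarith)).mul_left _) (fun n => ?_) ?_
  · have := (tendsto_risingQuot a v n).const_mul (risingSqDiff c n)
    rwa [mul_comm] at this
  · filter_upwards [tendsto_comap.eventually (eventually_ge_atTop T)] with t ht n
    have hn : (0 : ℝ) < (n : ℝ) + 1 := by positivity
    have h2 := hq t ht n
    rw [hav] at h2
    rw [norm_mul]
    calc _ ≤ (K * ((n : ℝ) + 1) ^ (2 * c.re - 3)) * (K' * ((n : ℝ) + 1) ^ (1 - c.re)) :=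
          mul_le_mul (hβ n) h2 (norm_nonneg _) (by positivity)
      _ = K * K' * (((n : ℝ) + 1) ^ (2 * c.re - 3) * ((n : ℝ) + 1) ^ (1 - c.re)) := by ring
      _ = _ := by rw [← Real.rpow_add hn]; ring_nf

lemma tendsto_sqrt_one_add_div :
    Tendsto (fun t : ℝ => (1 + |t|) ^ (1 / 2 : ℝ) / √|t|) (comap (fun t : ℝ => |t|) atTop) (𝓝 1) := by
  have h1 : Tendsto (fun x : ℝ => √((1 + x) / x)) atTop (𝓝 1) := by
    have h2 : Tendsto (fun x : ℝ => 1 + x⁻¹) atTop (𝓝 (1 + 0)) :=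
      tendsto_inv_atTop_zero.const_add 1
    rw [add_zero] at h2
    have h3 := h2.sqrt
    rw [Real.sqrt_one] at h3
    refine h3.congr' ?_
    filter_upwards [eventually_gt_atTop 0] with x hx
    congr 1
    field_simp
    ring
  refine (h1.comp tendsto_comap).congr fun t => ?_
  simp only [Function.comp]
  rw [← Real.sqrt_eq_rpow, Real.sqrt_div (by positivity)]

lemma exists_tendsto_norm_normalizedProductMellin {p : ℤ} {s₀ : ℂ} (hp : |(p : ℝ)| ≤ 1)
    (h0 : 0 < s₀.re) (h1 : s₀.re < 1) :
    ∃ c : ℝ, 0 < c ∧ Tendsto (fun t : ℝ => ‖normalizedProductMellin p s₀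
      (1 / 2 + Complex.I * t) (1 - (1 / 2 + Complex.I * t))‖ / (1 + |t|) ^ (-(1 / 2) : ℝ))
      (comap (fun t : ℝ => |t|) atTop) (𝓝 c) := by
  have g0 := Complex.Gamma_ne_zero_of_re_pos h0
  have g1 : Complex.Gamma (1 - s₀) ≠ 0 := Complex.Gamma_ne_zero_of_re_pos (by simpa using h1)
  have hS := tsum_alternating_risingSqDiff_ne_zero h0 h1
  set a : ℝ := 1 / 2 - p / 4 with ha
  set v : ℂ := s₀ - 1 / 2 - (p : ℂ) / 4 with hv
  have hav : a - v.re = 1 - s₀.re := by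
    rw [hv, re_sub_intCast_div]
    simp [ha]
    ring
  refine ⟨‖Complex.Gamma s₀ * Complex.Gamma (1 - s₀)‖ * (2 ^ (2 - s₀.re) * √Real.pi)⁻¹ *
    ‖∑' n, (-1) ^ n * risingSqDiff s₀ n‖, ?_, ?_⟩
  · have k1 := norm_pos_iff.mpr (mul_ne_zero g0 g1)
    have k2 := norm_pos_iff.mpr hS
    have k3 := Real.sqrt_pos.mpr Real.pi_pos
    positivity
  · have l1 := tendsto_sqrt_mul_norm_Gamma_div s₀ (p / 4)
    have l2 := (tendsto_tsum_risingSqDiff_mul_risingQuot h0 h1 hav).norm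
    have l3 := ((l1.const_mul ‖Complex.Gamma s₀ * Complex.Gamma (1 - s₀)‖).mul l2).mul
      tendsto_sqrt_one_add_div
    rw [mul_one] at l3
    refine l3.congr' ?_
    obtain ⟨T, M, hT, hM, hq⟩ := exists_norm_risingQuot_le a (v := v) (by rw [hav]; linarith)
    rw [hav] at hq
    filter_upwards [tendsto_comap.eventually (eventually_ge_atTop T),
      tendsto_comap.eventually (eventually_gt_atTop ‖s₀ - 1‖),
      tendsto_comap.eventually (eventually_gt_atTop ‖v‖)] with t h2 h3 h4
    have ht0 : 0 < |t| := by linarith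
    rw [normalizedProductMellin_eq_tsum hp h0 h1 h3 h4 (hq t h2), norm_mul, norm_mul,
      Real.rpow_neg (by positivity)]
    have hs : √|t| ≠ 0 := (Real.sqrt_pos.mpr ht0).ne'
    rw [div_inv_eq_mul, mul_div_assoc', mul_comm (√|t|) ‖_‖, ← mul_assoc, mul_right_comm _ (√|t|),
      mul_right_comm _ (√|t|), mul_div_assoc, div_self hs, mul_one]
    simp only [norm_mul, ha, hv]

/-! ### Part (b): the squared modulus of one Whittaker function. -/

lemma conj_eulerKernel (a d : ℂ) {v : ℝ} (hv : 0 < v) :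
    (starRingEnd ℂ) (eulerKernel a d v) =
      eulerKernel ((starRingEnd ℂ) a) ((starRingEnd ℂ) d) v := by
  have e3 : (1 + (v : ℂ)) = ((1 + v : ℝ) : ℂ) := by push_cast; rfl
  have h : ∀ {x : ℝ} (w : ℂ), 0 < x →
      (starRingEnd ℂ) ((x : ℂ) ^ w) = (x : ℂ) ^ (starRingEnd ℂ) w := fun {x} w hx => by
    rw [Complex.cpow_conj _ _ (by
      rw [Complex.arg_ofReal_of_nonneg hx.le]; exact Real.pi_pos.ne), Complex.conj_ofReal]
  rw [eulerKernel, eulerKernel, map_mul, e3, h _ hv, h _ (by linarith)]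
  simp

lemma conj_eulerLaplace (a d : ℂ) (y : ℝ) :
    (starRingEnd ℂ) (eulerLaplace a d y) =
      eulerLaplace ((starRingEnd ℂ) a) ((starRingEnd ℂ) d) y := by
  rw [eulerLaplace, eulerLaplace, ← integral_conj]
  refine setIntegral_congr_fun measurableSet_Ioi fun v hv => ?_
  rw [map_mul, conj_eulerKernel a d hv, ← Complex.exp_conj]
  simp

/-- Writing the squared modulus as a function times its conjugate gives a product of two Laplace
transforms with conjugate parameters, to which the series expansion applies. -/
lemma sq_norm_whittakerW (κ : ℂ) (t : ℝ) {y : ℝ} (hy : 0 < y) :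
    ((‖whittakerW κ (Complex.I * t) y‖ ^ 2 : ℝ) : ℂ) =
      1 / ((‖Complex.Gamma (1 / 2 + Complex.I * t - κ)‖ ^ 2 : ℝ) : ℂ) *
        (Complex.exp (-(y : ℂ)) * y * (eulerLaplace (1 / 2 + Complex.I * t - κ)
          (1 / 2 + Complex.I * t + κ) y *
        eulerLaplace ((starRingEnd ℂ) (1 / 2 + Complex.I * t - κ))
          ((starRingEnd ℂ) (1 / 2 + Complex.I * t + κ)) y)) := by
  have h1 : ‖Complex.exp (-(y : ℂ) / 2)‖ ^ 2 = Real.exp (-y) := by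
    rw [Complex.norm_exp, ← Real.exp_nat_mul]
    congr 1
    simp
    ring
  have h2 : ‖(y : ℂ) ^ (Complex.I * t + 1 / 2)‖ ^ 2 = y := by
    rw [Complex.norm_cpow_eq_rpow_re_of_pos hy, ← Real.rpow_natCast, ← Real.rpow_mul hy.le]
    simp
  rw [← conj_eulerLaplace, Complex.mul_conj, Complex.normSq_eq_norm_sq, whittakerW_eq_eulerLaplace,
    norm_mul, norm_div, norm_mul, mul_pow, div_pow, mul_pow, h1, h2]
  push_cast
  ring

section Square

variable {p : ℤ}

lemma whittakerSquareIntegrand_eq (p : ℤ) (u t : ℝ) {y : ℝ} (hy : 0 < y) :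
    whittakerSquareIntegrand p u t y =
      1 / ((‖Complex.Gamma (1 / 2 + Complex.I * t - (p : ℂ) / 4)‖ ^ 2 : ℝ) : ℂ) *
        ((y : ℂ) ^ ((1 / 2 + Complex.I * u : ℂ) - 1) * Complex.exp (-(y : ℂ)) *
          (eulerLaplace (1 / 2 + Complex.I * t - (p : ℂ) / 4)
            (1 / 2 + Complex.I * t + (p : ℂ) / 4) y *
          eulerLaplace ((starRingEnd ℂ) (1 / 2 + Complex.I * t - (p : ℂ) / 4))
            ((starRingEnd ℂ) (1 / 2 + Complex.I * t + (p : ℂ) / 4)) y)) := by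
  have hy0 : (y : ℂ) ≠ 0 := by exact_mod_cast hy.ne'
  have e : (1 / 2 + Complex.I * u : ℂ) - 1 = -(1 / 2 : ℂ) + Complex.I * u := by ring
  rw [whittakerSquareIntegrand, sq_norm_whittakerW _ _ hy, e]
  field_simp

lemma half_add_I_mul_re (t : ℝ) : (1 / 2 + Complex.I * t : ℂ).re = 1 / 2 := by
  simp

lemma integrableOn_whittakerSquareIntegrand (hp : |(p : ℝ)| ≤ 1) (u t : ℝ) :
    IntegrableOn (whittakerSquareIntegrand p u t) (Ioi 0) := by
  obtain ⟨hp1, hp2⟩ := abs_le.mp hp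
  -- Both kernels satisfy `Re a + Re d = 1`, so the symmetric split `θ = 1/2` leaves `0 < 1/4`
  -- twice.
  have h := integrableOn_eulerLaplace_mul (c := 1 / 2 + Complex.I * u)
    (a₁ := 1 / 2 + Complex.I * t - (p : ℂ) / 4) (d₁ := 1 / 2 + Complex.I * t + (p : ℂ) / 4)
    (a₂ := (starRingEnd ℂ) (1 / 2 + Complex.I * t - (p : ℂ) / 4))
    (d₂ := (starRingEnd ℂ) (1 / 2 + Complex.I * t + (p : ℂ) / 4)) (θ := 1 / 2)
    (by rw [half_add_I_mul_re]; norm_num)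
    (by rw [re_sub_intCast_div, half_add_I_mul_re]; linarith)
    (by rw [Complex.conj_re, re_sub_intCast_div, half_add_I_mul_re]; linarith)
    (by norm_num) (by norm_num)
    (by rw [re_sub_intCast_div, re_add_intCast_div, half_add_I_mul_re, half_add_I_mul_re]; linarith)
    (by rw [Complex.conj_re, Complex.conj_re, re_sub_intCast_div, re_add_intCast_div,
      half_add_I_mul_re, half_add_I_mul_re]; linarith)
  exact IntegrableOn.congr_fun (h.const_mul _)
    (fun y hy => (whittakerSquareIntegrand_eq p u t hy).symm) measurableSet_Ioi

/-- The factor `y^(iu)` has modulus one, and the integrand at `u = 0` is nonnegative. This is the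
source of uniformity in `u`. -/
lemma norm_integral_whittakerSquareIntegrand_le (p : ℤ) (u t : ℝ) :
    ‖∫ y in Ioi (0 : ℝ), whittakerSquareIntegrand p u t y‖ ≤
      ‖∫ y in Ioi (0 : ℝ), whittakerSquareIntegrand p 0 t y‖ := by
  have h : ∀ u : ℝ, ∀ y ∈ Ioi (0 : ℝ), ‖whittakerSquareIntegrand p u t y‖ =
      y ^ (-(1 / 2) : ℝ) * ‖whittakerW ((p : ℂ) / 4) (Complex.I * t) y‖ ^ 2 / y := by
    intro u y hy
    have hy : 0 < y := hy
    rw [whittakerSquareIntegrand, norm_div, norm_mul, Complex.norm_real, Complex.norm_real,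
      Complex.norm_cpow_eq_rpow_re_of_pos hy, Real.norm_of_nonneg hy.le,
      Real.norm_of_nonneg (by positivity)]
    congr 3
    simp
  have h0 : ∀ y ∈ Ioi (0 : ℝ), whittakerSquareIntegrand p 0 t y =
      ((‖whittakerSquareIntegrand p u t y‖ : ℝ) : ℂ) := by
    intro y hy
    rw [h u y hy, whittakerSquareIntegrand, Complex.ofReal_div, Complex.ofReal_mul,
      Complex.ofReal_cpow (le_of_lt hy)]
    simp
  rw [setIntegral_congr_fun measurableSet_Ioi h0, integral_complex_ofReal, Complex.norm_real,
    Real.norm_of_nonneg (integral_nonneg fun y => norm_nonneg _)]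
  exact norm_integral_le_integral_norm _

/-- Series of positive terms for `∫ y ^ (-1/2) |W(y)|² dy / y`. -/
lemma hasSum_integral_whittakerSquareIntegrand (hp : |(p : ℝ)| ≤ 1) (t : ℝ) :
    HasSum (fun n : ℕ => Complex.Gamma (1 / 2) * risingCoeff (1 / 2) n *
      ((‖Complex.Gamma (n + Complex.I * t + (1 / 2 - p / 4 : ℝ)) *
        Complex.Gamma (1 / 2 - 2 * (Complex.I * t)) /
          Complex.Gamma (n - Complex.I * t + (1 - p / 4 : ℝ))‖ ^ 2 : ℝ) : ℂ))
      (((‖Complex.Gamma (1 / 2 + Complex.I * t - (p : ℂ) / 4)‖ ^ 2 : ℝ) : ℂ) *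
        ∫ y in Ioi (0 : ℝ), whittakerSquareIntegrand p 0 t y) := by
  obtain ⟨hp1, hp2⟩ := abs_le.mp hp
  have e0 : (1 / 2 : ℂ).re = 1 / 2 := by simp
  have h := hasSum_integral_eulerLaplace_mul (c := 1 / 2)
    (a₁ := 1 / 2 + Complex.I * t - (p : ℂ) / 4) (d₁ := 1 / 2 + Complex.I * t + (p : ℂ) / 4)
    (a₂ := (starRingEnd ℂ) (1 / 2 + Complex.I * t - (p : ℂ) / 4))
    (d₂ := (starRingEnd ℂ) (1 / 2 + Complex.I * t + (p : ℂ) / 4)) (θ := 1 / 2)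
    (by rw [e0]; norm_num)
    (by rw [re_sub_intCast_div, half_add_I_mul_re]; linarith)
    (by rw [Complex.conj_re, re_sub_intCast_div, half_add_I_mul_re]; linarith)
    (by norm_num) (by norm_num)
    (by rw [re_sub_intCast_div, re_add_intCast_div, half_add_I_mul_re, e0]; linarith)
    (by rw [Complex.conj_re, Complex.conj_re, re_sub_intCast_div, re_add_intCast_div,
      half_add_I_mul_re, e0]; linarith)
  have hG : Complex.Gamma (1 / 2 + Complex.I * t - (p : ℂ) / 4) ≠ 0 :=
    Complex.Gamma_ne_zero_of_re_pos (by rw [re_sub_intCast_div, half_add_I_mul_re]; linarith)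
  have hG2 : ((‖Complex.Gamma (1 / 2 + Complex.I * t - (p : ℂ) / 4)‖ ^ 2 : ℝ) : ℂ) ≠ 0 := by
    exact_mod_cast pow_ne_zero 2 (norm_ne_zero_iff.mpr hG)
  have hI := setIntegral_congr_fun (μ := volume) (measurableSet_Ioi (a := (0 : ℝ)))
    fun y hy => whittakerSquareIntegrand_eq p 0 t (mem_Ioi.mp hy)
  rw [integral_const_mul, Complex.ofReal_zero, mul_zero, add_zero, one_div_mul_eq_div,
    eq_div_iff hG2] at hI
  rw [mul_comm (Complex.ofReal _), hI]
  convert! h using 1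
  ext n
  set a : ℂ := 1 / 2 + Complex.I * t - (p : ℂ) / 4 with ha
  set d : ℂ := 1 / 2 + Complex.I * t + (p : ℂ) / 4 with hd
  have e1 : (n : ℂ) + Complex.I * t + ((1 / 2 - p / 4 : ℝ) : ℂ) = a + n := by
    rw [ha]; push_cast; ring
  have e2 : 1 / 2 - 2 * (Complex.I * t) = 1 / 2 + 1 - a - d := by rw [ha, hd]; ring
  have e3 : (n : ℂ) - Complex.I * t + ((1 - p / 4 : ℝ) : ℂ) = a + n + (1 / 2 + 1 - a - d) := by
    rw [ha, hd]; push_cast; ring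
  have hc : Complex.Gamma ((starRingEnd ℂ) a + n) *
      Complex.Gamma (1 / 2 + 1 - (starRingEnd ℂ) a - (starRingEnd ℂ) d) /
      Complex.Gamma ((starRingEnd ℂ) a + n + (1 / 2 + 1 - (starRingEnd ℂ) a - (starRingEnd ℂ) d)) =
      (starRingEnd ℂ) (Complex.Gamma (a + n) * Complex.Gamma (1 / 2 + 1 - a - d) /
        Complex.Gamma (a + n + (1 / 2 + 1 - a - d))) := by
    rw [map_div₀, map_mul, ← Complex.Gamma_conj, ← Complex.Gamma_conj, ← Complex.Gamma_conj]
    simp [Complex.conj_ofNat]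
  rw [e1, e2, e3, hc, Complex.mul_conj, Complex.normSq_eq_norm_sq]

/-- For `p = ±1` the numbers `1/2 ∓ p/4` are `1/4` and `3/4`, so the right side is a duplication
product. It equals the left side times `√2 √π ≥ 1`. -/
lemma norm_Gamma_half_sub_le (hp : p = 1 ∨ p = -1) (t : ℝ) :
    ‖Complex.Gamma (1 / 2 - 2 * (Complex.I * t))‖ ≤
      ‖Complex.Gamma (1 / 2 + Complex.I * t - (p : ℂ) / 4)‖ *
        ‖Complex.Gamma (1 / 2 + (p : ℂ) / 4 + Complex.I * t)‖ := by
  have hdup := congrArg norm (Complex.Gamma_mul_Gamma_add_half (1 / 4 + Complex.I * t))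
  have e1 : (1 / 4 + Complex.I * t + 1 / 2 : ℂ) = 3 / 4 + Complex.I * t := by ring
  have e2 : (2 * (1 / 4 + Complex.I * t) : ℂ) = ((1 / 2 : ℝ) : ℂ) + Complex.I * (2 * t : ℝ) := by
    push_cast; ring
  have hp2 : ‖(2 : ℂ) ^ (1 - (((1 / 2 : ℝ) : ℂ) + Complex.I * (2 * t : ℝ)))‖ = 2 ^ (1 / 2 : ℝ) := by
    have := Complex.norm_cpow_eq_rpow_re_of_pos (x := 2) two_pos
      (1 - (((1 / 2 : ℝ) : ℂ) + Complex.I * (2 * t : ℝ)))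
    push_cast at this ⊢
    rw [this]
    congr 1
    simp
    norm_num
  rw [e1, e2, norm_mul, norm_mul, norm_mul, hp2, ← norm_Gamma_sub_I_mul, Complex.norm_real,
    Real.norm_of_nonneg (Real.sqrt_nonneg _)] at hdup
  have e3 : (1 / 2 - 2 * (Complex.I * t) : ℂ) = ((1 / 2 : ℝ) : ℂ) - Complex.I * (2 * t : ℝ) := by
    push_cast; ring
  have hle : ‖Complex.Gamma (1 / 2 - 2 * (Complex.I * t))‖ ≤
      ‖Complex.Gamma (1 / 4 + Complex.I * t)‖ * ‖Complex.Gamma (3 / 4 + Complex.I * t)‖ := by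
    rw [hdup, e3, mul_assoc]
    refine le_mul_of_one_le_right (norm_nonneg _) (one_le_mul_of_one_le_of_one_le ?_ ?_)
    · exact Real.one_le_rpow (by norm_num) (by norm_num)
    · exact Real.one_le_sqrt.mpr (by linarith [Real.pi_gt_three])
  refine hle.trans (le_of_eq ?_)
  rcases hp with rfl | rfl
  · congr 3 <;> push_cast <;> ring
  · rw [mul_comm]
    congr 3 <;> push_cast <;> ring

lemma sum_inv_sqrt_mul_add_le {T : ℝ} (hT : 0 < T) (N : ℕ) :
    ∑ n ∈ Finset.range N, 1 / (√((n : ℝ) + 1) * ((n : ℝ) + 1 + T)) ≤ 4 / √T := by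
  have hq : 0 < √T := Real.sqrt_pos.mpr hT
  -- The function `√N/(√N + √T)` has increments of the order of the summand and stays below `1`,
  -- which permits a telescoping induction.
  have h : ∑ n ∈ Finset.range N, 1 / (√((n : ℝ) + 1) * ((n : ℝ) + 1 + T)) ≤
      4 / √T * (√N / (√N + √T)) := by
    induction N with
    | zero => simp
    | succ n ih =>
      rw [Finset.sum_range_succ]
      push_cast
      have hx0 : 0 < √((n : ℝ) + 1) := Real.sqrt_pos.mpr (by positivity)
      have hy0 : 0 ≤ √(n : ℝ) := Real.sqrt_nonneg _
      have hxy : √(n : ℝ) ≤ √((n : ℝ) + 1) := Real.sqrt_le_sqrt (by linarith)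
      have hx2 : √((n : ℝ) + 1) ^ 2 = n + 1 := Real.sq_sqrt (by positivity)
      have hy2 : √(n : ℝ) ^ 2 = n := Real.sq_sqrt (by positivity)
      have hq2 : √T ^ 2 = T := Real.sq_sqrt hT.le
      set x := √((n : ℝ) + 1)
      set y := √(n : ℝ)
      set q := √T
      have key : 1 / (x * ((n : ℝ) + 1 + T)) ≤ 4 / q * (x / (x + q) - y / (y + q)) := by
        have e1 : 4 / q * (x / (x + q) - y / (y + q)) = 4 * (x - y) / ((x + q) * (y + q)) := by
          field_simp
          ring
        rw [e1, ← hx2, ← hq2, div_le_div_iff₀ (by positivity) (by positivity)]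
        have h1 : (x - y) * (x + y) = 1 := by nlinarith
        have h2 : (x + q) * (y + q) ≤ 2 * (x ^ 2 + q ^ 2) := by nlinarith [sq_nonneg (x - q)]
        have h3 : 1 ≤ (x - y) * (2 * x) := by
          rw [← h1]
          exact mul_le_mul_of_nonneg_left (by linarith) (by linarith)
        have h4 : 0 ≤ 2 * (x ^ 2 + q ^ 2) := by positivity
        have h5 := mul_le_mul_of_nonneg_right h3 h4
        linarith
      rw [mul_sub] at key
      linarith
  refine h.trans (mul_le_of_le_one_right (by positivity) ?_)
  rw [div_le_one (by positivity)]
  linarith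

lemma inv_norm_natCast_add_I_mul_le {t : ℝ} (ht : 1 ≤ |t|) (n : ℕ) :
    1 / ‖(n : ℂ) + Complex.I * t‖ ≤ 4 * (1 / ((n : ℝ) + 1 + |t|)) := by
  have hn : (0 : ℝ) ≤ n := n.cast_nonneg
  have h1 := Complex.abs_re_le_norm ((n : ℂ) + Complex.I * t)
  have h2 := Complex.abs_im_le_norm ((n : ℂ) + Complex.I * t)
  simp at h1 h2
  rw [mul_one_div, div_le_div_iff₀ (by linarith) (by positivity)]
  linarith

/-- Uniform bound for the normalized Mellin integral of `|W|²`. -/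
lemma exists_norm_normalizedSquareMellin_le (hp : p = 1 ∨ p = -1) :
    ∃ C T : ℝ, ∀ u t : ℝ, T ≤ |t| →
      ‖normalizedSquareMellin p u t‖ ≤ C * (1 + |t|) ^ (-(1 / 2) : ℝ) := by
  have hp' := abs_intCast_le_one hp
  obtain ⟨hp1, hp2⟩ := abs_le.mp hp'
  obtain ⟨T, K, hT, hK, hg⟩ := norm_Gamma_div_Gamma_le (1 / 2 - p / 4 : ℝ) (1 - p / 4 : ℝ)
  obtain ⟨K', hK', hr⟩ := exists_norm_risingCoeff_le (c := 1 / 2) (by simp)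
  have hexp : (((1 / 2 - p / 4 : ℝ) : ℂ) - ((1 - p / 4 : ℝ) : ℂ)).re = -(1 / 2) := by
    rw [Complex.sub_re, Complex.ofReal_re, Complex.ofReal_re]; ring
  have hre : (1 / 2 : ℂ).re = 1 / 2 := by simp
  rw [hexp] at hg
  rw [hre] at hr
  refine ⟨‖Complex.Gamma (1 / 2)‖ * (K' * K ^ 2 * 4) * 4 * √2, T, fun u t ht => ?_⟩
  have ht1 : 1 ≤ |t| := hT.trans ht
  set B := ‖Complex.Gamma (1 / 2 - 2 * (Complex.I * t))‖ with hB
  set A := ‖Complex.Gamma (1 / 2 + Complex.I * t - (p : ℂ) / 4)‖ with hA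
  set D := ‖Complex.Gamma (1 / 2 + (p : ℂ) / 4 + Complex.I * t)‖ with hD
  have hA0 : 0 < A := norm_pos_iff.mpr (Complex.Gamma_ne_zero_of_re_pos (by
    rw [re_sub_intCast_div, half_add_I_mul_re]; linarith))
  have hD0 : 0 < D := norm_pos_iff.mpr (Complex.Gamma_ne_zero_of_re_pos (by
    simp; linarith))
  have hBAD : B ≤ A * D := norm_Gamma_half_sub_le hp t
  have hterm : ∀ n : ℕ, ‖Complex.Gamma (1 / 2) * risingCoeff (1 / 2) n *
      ((‖Complex.Gamma (n + Complex.I * t + (1 / 2 - p / 4 : ℝ)) *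
        Complex.Gamma (1 / 2 - 2 * (Complex.I * t)) /
          Complex.Gamma (n - Complex.I * t + (1 - p / 4 : ℝ))‖ ^ 2 : ℝ) : ℂ)‖ ≤
      ‖Complex.Gamma (1 / 2)‖ * (K' * K ^ 2 * 4) * B ^ 2 *
        (1 / (√((n : ℝ) + 1) * ((n : ℝ) + 1 + |t|))) := by
    intro n
    have hn : (0 : ℝ) < (n : ℝ) + 1 := by positivity
    have k1 := hg (n + Complex.I * t) (by simp) (by simpa using ht)
    have e1 : ‖Complex.Gamma (n - Complex.I * t + (1 - p / 4 : ℝ))‖ =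
        ‖Complex.Gamma (n + Complex.I * t + (1 - p / 4 : ℝ))‖ := by
      have := norm_Gamma_sub_I_mul (κ := n + (1 - p / 4)) t
      rw [Complex.ofReal_add, Complex.ofReal_natCast] at this
      rw [show (n : ℂ) - Complex.I * t + ((1 - p / 4 : ℝ) : ℂ) =
        n + ((1 - p / 4 : ℝ) : ℂ) - Complex.I * t by ring, this]
      congr 2
      ring
    have hpos : 0 < ‖(n : ℂ) + Complex.I * t‖ := by
      have := Complex.abs_im_le_norm ((n : ℂ) + Complex.I * t)
      simp at this
      linarith
    have k2 : (‖(n : ℂ) + Complex.I * t‖ ^ (-(1 / 2) : ℝ)) ^ 2 ≤ 4 * (1 / ((n : ℝ) + 1 + |t|)) := by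
      rw [← Real.rpow_natCast, ← Real.rpow_mul hpos.le]
      norm_num
      have := inv_norm_natCast_add_I_mul_le ht1 n
      rw [one_div, one_div] at this
      rwa [Real.rpow_neg_one]
    have k3 : ((n : ℝ) + 1) ^ (1 / 2 - 1 : ℝ) = 1 / √((n : ℝ) + 1) := by
      rw [Real.sqrt_eq_rpow, one_div (((n : ℝ) + 1) ^ (1 / 2 : ℝ)), ← Real.rpow_neg hn.le]
      norm_num
    have k4 := hr n
    rw [k3] at k4
    rw [norm_div] at k1
    rw [norm_mul, norm_mul, Complex.norm_real, Real.norm_of_nonneg (by positivity), norm_div,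
      norm_mul, e1, mul_div_right_comm, mul_pow]
    calc _ ≤ ‖Complex.Gamma (1 / 2)‖ * (K' * (1 / √((n : ℝ) + 1))) *
          ((K * ‖(n : ℂ) + Complex.I * t‖ ^ (-(1 / 2) : ℝ)) ^ 2 * B ^ 2) := by
          gcongr
      _ = ‖Complex.Gamma (1 / 2)‖ * (K' * (1 / √((n : ℝ) + 1))) * (K ^ 2 * B ^ 2) *
          (‖(n : ℂ) + Complex.I * t‖ ^ (-(1 / 2) : ℝ)) ^ 2 := by ring
      _ ≤ ‖Complex.Gamma (1 / 2)‖ * (K' * (1 / √((n : ℝ) + 1))) * (K ^ 2 * B ^ 2) *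
          (4 * (1 / ((n : ℝ) + 1 + |t|))) := by gcongr
      _ = _ := by field_simp
  have hS := (hasSum_integral_whittakerSquareIntegrand hp' t).tendsto_sum_nat.norm
  -- The bound holds for all partial sums and passes to the limit.
  have hle := le_of_tendsto' hS fun N => (norm_sum_le_of_le _ fun n _ => hterm n).trans (by
    rw [← Finset.mul_sum]
    exact mul_le_mul_of_nonneg_left (sum_inv_sqrt_mul_add_le (by linarith) N) (by positivity))
  rw [norm_mul, Complex.norm_real, Real.norm_of_nonneg (by positivity)] at hle
  -- The `√2` comes from `1 + |t| ≤ 2|t|`.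
  have hsq : 1 / √|t| ≤ √2 * (1 + |t|) ^ (-(1 / 2) : ℝ) := by
    rw [Real.rpow_neg (by positivity), ← Real.sqrt_eq_rpow, ← div_eq_mul_inv,
      ← Real.sqrt_div (by positivity), one_div, ← Real.sqrt_inv]
    refine Real.sqrt_le_sqrt ?_
    rw [inv_eq_one_div, div_le_div_iff₀ (by linarith) (by positivity)]
    linarith
  rw [normalizedSquareMellin, norm_mul, norm_div, norm_one, Complex.norm_real,
    Real.norm_of_nonneg (by positivity)]
  have hAD : 0 < A * D := by positivity
  have hB2 : B ^ 2 ≤ (A * D) ^ 2 := pow_le_pow_left₀ (norm_nonneg _) hBAD 2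
  calc _ ≤ 1 / D ^ 2 * ‖∫ y in Ioi (0 : ℝ), whittakerSquareIntegrand p 0 t y‖ := by
        gcongr
        exact norm_integral_whittakerSquareIntegrand_le p u t
    _ = 1 / (A * D) ^ 2 * (A ^ 2 * ‖∫ y in Ioi (0 : ℝ), whittakerSquareIntegrand p 0 t y‖) := by
        field_simp
    _ ≤ 1 / (A * D) ^ 2 *
        (‖Complex.Gamma (1 / 2)‖ * (K' * K ^ 2 * 4) * B ^ 2 * (4 / √|t|)) := by gcongr
    _ ≤ 1 / (A * D) ^ 2 *
        (‖Complex.Gamma (1 / 2)‖ * (K' * K ^ 2 * 4) * (A * D) ^ 2 * (4 / √|t|)) := by gcongr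
    _ = ‖Complex.Gamma (1 / 2)‖ * (K' * K ^ 2 * 4) * 4 * (1 / √|t|) := by field_simp
    _ ≤ ‖Complex.Gamma (1 / 2)‖ * (K' * K ^ 2 * 4) * 4 * (√2 * (1 + |t|) ^ (-(1 / 2) : ℝ)) := by
        gcongr
    _ = _ := by ring

end Square

theorem mainTheorem11 (p : ℤ) (hp : p = 1 ∨ p = -1) :
    (∀ s₀ : ℂ, 0 < s₀.re → s₀.re < 1 →
      (∀ t : ℝ, ∀ s w : ℂ, s = 1 / 2 + Complex.I * t → w = 1 - s →
        IntegrableOn (whittakerProductIntegrand p s₀ s w) (Ioi 0)) ∧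
      ((fun t : ℝ => normalizedProductMellin p s₀
          (1 / 2 + Complex.I * t) (1 - (1 / 2 + Complex.I * t)))
        =O[comap (fun t : ℝ => |t|) atTop] fun t : ℝ => (1 + |t|) ^ (-(1 / 2) : ℝ)) ∧
      ∃ c : ℝ, 0 < c ∧
        Tendsto (fun t : ℝ =>
          ‖normalizedProductMellin p s₀
            (1 / 2 + Complex.I * t) (1 - (1 / 2 + Complex.I * t))‖ / (1 + |t|) ^ (-(1 / 2) : ℝ))
          (comap (fun t : ℝ => |t|) atTop) (𝓝 c)) ∧
    ((∀ u t : ℝ, IntegrableOn (whittakerSquareIntegrand p u t) (Ioi 0)) ∧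
      ∃ C T : ℝ, ∀ u t : ℝ, T ≤ |t| →
        ‖normalizedSquareMellin p u t‖ ≤ C * (1 + |t|) ^ (-(1 / 2) : ℝ)) := by
  have hp' := abs_intCast_le_one hp
  refine ⟨fun s₀ h0 h1 => ⟨fun t s w hs hw => ?_, ?_, ?_⟩,
    integrableOn_whittakerSquareIntegrand hp', exists_norm_normalizedSquareMellin_le hp⟩
  · refine integrableOn_whittakerProductIntegrand hp' h0 h1 (by rw [hw]; ring) ?_
    rw [hw, hs, Complex.sub_re, half_add_I_mul_re, Complex.one_re]
    norm_num
  · obtain ⟨c, -, hc⟩ := exists_tendsto_norm_normalizedProductMellin hp' h0 h1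
    refine IsBigO.of_norm_left (isBigO_of_div_tendsto_nhds ?_ c hc)
    refine Eventually.of_forall fun t ht => ?_
    have : 0 < (1 + |t|) ^ (-(1 / 2) : ℝ) := by positivity
    exact absurd ht this.ne'
  · exact exists_tendsto_norm_normalizedProductMellin hp' h0 h1
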